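/- For permutations $\sigma$ and $\pi$, an occurrence of $\pi$ in $\sigma$ is a subsequence of $\sigma$ (in one-line notation) whose entries have the same pairwise comparisons as those of $\pi$. Let $[k]$ denote the permutation $k\cdots 21$. Let $I_n(;3412,\pi)$ be the set of involutions of $\{1,\dots,n\}$ that contain exactly one occurrence of $3412$ and exactly one occurrence of $\pi$, and let $$Q^+_\pi(x)=\sum_{n\ge 0}|I_n(;3412,\pi)|\,x^n .$$ Let $U_n$ be the $n$th Chebyshev polynomial of the second kind ($U_n(\cos t)=\sin((n+1)t)/\sin t$ for $n\ge 0$, and $U_{-1}=0$), and put $V_n(x)=U_n\!\left(\frac{1-x}{2x}\right)$ and $Y_n(x)=V_n(x)+V_{n-1}(x)$. Identities between power series and rational functions are understood in the field of formal Laurent series in $x$ over $\mathbb{Q}$. **Theorem.** For all $k\ge 2$, $$Q^+_{[2k]}(x)=\frac{2x}{(1-x)V_k^2(x)}\sum_{i=2}^{k}\frac{\left(1-x^{2(i-1)}\right)V_{i-2}(x)V_i(x)+\sum_{j=0}^{i-2}\left(1-x^{2(j+1)}\right)V_j^2(x)}{V_{i-1}(x)V_i(x)}$$ and $$Q^+_{[2k+1]}(x)=\frac{2}{(1-x)Y_{k+1}^2(x)}\sum_{i=0}^{k-1}\frac{\left(1-x^{2i+1}\right)Y_i(x)Y_{i+2}(x)+\sum_{j=0}^{i}\left(1-x^{2j+1}\right)Y_j^2(x)}{Y_{i+1}(x)Y_{i+2}(x)}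 .$$ Moreover, for all $n\ge 6$, $$|I_n(;3412,4321)|=(3n^2-23n+38)\,2^{n-8}.$$ -/

import Mathlib

namespace RestrictedInvolutions

/-- The number of subsequences of type `π` in `σ`: a subsequence of length `k` is given by its
positions, a strictly increasing `f : Fin k → Fin n`, and it has type `π` when its entries compare
pairwise as those of `π` do. -/
def occurrences {n k : ℕ} (σ : Equiv.Perm (Fin n)) (π : Equiv.Perm (Fin k)) : ℕ :=
  Fintype.card {f : Fin k → Fin n //
    (∀ a b, a < b → f a < f b) ∧ ∀ a b, σ (f a) < σ (f b) ↔ π a < π b}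

/-- The permutation `3412` (on the letters `0, 1, 2, 3`). -/
def perm3412 : Equiv.Perm (Fin 4) where
  toFun := ![2, 3, 0, 1]
  invFun := ![2, 3, 0, 1]
  left_inv := by decide
  right_inv := by decide

/-- The decreasing permutation `[k] = k ⋯ 2 1`. -/
def decreasing (k : ℕ) : Equiv.Perm (Fin k) := Fin.revPerm

/-- `I_n(;3412, π)`: the involutions of length `n` which contain exactly one subsequence of type
`3412` and exactly one subsequence of type `π`. -/
def involutionsOnce (n : ℕ) {k : ℕ} (π : Equiv.Perm (Fin k)) : Finset (Equiv.Perm (Fin n)) :=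
  Finset.univ.filter fun σ =>
    (∀ i, σ (σ i) = i) ∧ occurrences σ perm3412 = 1 ∧ occurrences σ π = 1

/-- `Q⁺_π(x) = ∑ x ^ |σ|`, over all involutions `σ`, of any length, which contain exactly one
subsequence of type `3412` and exactly one of type `π`. -/
def Qplus {k : ℕ} (π : Equiv.Perm (Fin k)) : PowerSeries ℚ :=
  PowerSeries.mk fun n => ((involutionsOnce n π).card : ℚ)

/-- The indeterminate `x`, in the field of Laurent series. -/
noncomputable def x : LaurentSeries ℚ := ((PowerSeries.X : PowerSeries ℚ) : LaurentSeries ℚ)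

/-- `V_n(x) = U_n((1 - x) / (2 x))`, with `U_n` the Chebyshev polynomial of the second kind and
`U_{-1} = 0`. Only indices `n ≥ -1` are used. -/
noncomputable def V (n : ℤ) : LaurentSeries ℚ :=
  Polynomial.aeval ((1 - x) / (2 * x)) (Polynomial.Chebyshev.U ℚ n)

/-- `Y_n(x) = V_n(x) + V_{n-1}(x)`. -/
noncomputable def Y (n : ℤ) : LaurentSeries ℚ := V n + V (n - 1)

end RestrictedInvolutions

/-!
Draw an involution as a diagram of arcs `i - σ i` and fixed points. If `p < q < r < u` are the
positions of an occurrence of `3412`, then the arcs at `p` and `q`, or those at `r` and `u`, cross;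
conversely a crossing is an occurrence of `3412`. So an involution with at most one occurrence has
at most one crossing, and then the letters under both crossing arcs must be reversed, as otherwise
they would take part in further occurrences. Such involutions have unique descriptions by
first-return decomposition (`ArcTree`, `exists_encodes_of_card_quads_le_one`,
`ArcTree.Encodes.unique`), in which the occurrences of `3412` are the nodes `crossing`
(`ArcTree.Encodes.card_quads`).

Decreasing subsequences follow this decomposition. They do not meet two summands of a direct sum,
and an arc adds its two ends to the longest ones below it; under a crossing with `m` letters in the
middle, `m` must be small, since each of the four pairs of a left and a right end extends the
middle, and then only the two sides matter. Hence "no decreasing subsequence of length `k + 2`" and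
"exactly one of length `k + 2`" are governed by the same properties for `k` of the enclosed parts
(`ArcTree.Encodes.avoid_and_once`). For the generating functions `F`, `G`, `P`, `Q` (no or one
crossing; no or one decreasing subsequence) this gives recurrences from `k` to `k + 2`, in which `F`
is a continued fraction and `G`, `P`, `Q` arise by the product rule (`ArcTree.genF_add_two`,
`ArcTree.genG_add_two`, `ArcTree.genP_add_two`, `ArcTree.genQ_add_two`).

If `v` is a solution of the Chebyshev recurrence with suitable initial values, then
`F = v i / (x v (i + 1))`, and multiplying `G`, `P`, `Q` by `v (i + 1) ^ 2` turns their recurrences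
into telescoping sums (`closed_form_of_recurrences`). The choices `v i = V (i - 1)` and `v i = Y i`
give the two formulas; for `k = 4` the generating function is `2 x ^ 6 (1 - x ^ 2) / (1 - 2 x) ^ 3`,
whose coefficients are explicit.
-/

/-! ### Arc diagrams -/

/-- Arc diagrams of involutions, read from left to right, in which arcs cross only in the
configuration `crossing`: a diagram is empty (`nil`), or begins with a fixed point (`point`), or
with an arc enclosing a diagram `c` and crossing nothing (`arc c t`), or with two crossing arcs.
In `crossing A m B t` the arcs join `a` to `b` and `c` to `d`, where `a < c < b < d`; the diagrams
`A` and `B` lie between `a` and `c` and between `b` and `d`, and the `m` letters between `c` and `b`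
are reversed. In each case `t` is what follows. -/
inductive ArcTree : Type
  | nil : ArcTree
  | point (t : ArcTree) : ArcTree
  | arc (c t : ArcTree) : ArcTree
  | crossing (A : ArcTree) (m : ℕ) (B t : ArcTree) : ArcTree

namespace ArcTree

/-- The number of letters of the involution. -/
def size : ArcTree → ℕ
  | nil => 0
  | point t => size t + 1
  | arc c t => size c + size t + 2
  | crossing A m B t => size A + m + size B + size t + 4

/-- The number of nodes `crossing`. -/
def crossings : ArcTree → ℕ
  | nil => 0
  | point t => crossings t
  | arc c t => crossings c + crossings t
  | crossing A _ B t => crossings A + crossings B + crossings t + 1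

/-- The function `f` acts on the interval `[o, o + size t)` as the involution with diagram `t`. -/
def Encodes (f : ℕ → ℕ) : ArcTree → ℕ → Prop
  | nil, _ => True
  | point t, o => f o = o ∧ Encodes f t (o + 1)
  | arc c t, o => f o = o + size c + 1 ∧ f (o + size c + 1) = o ∧
      Encodes f c (o + 1) ∧ Encodes f t (o + size c + 2)
  | crossing A m B t, o => f o = o + size A + m + 2 ∧
      f (o + size A + 1) = o + size A + m + size B + 3 ∧
      f (o + size A + m + 2) = o ∧
      f (o + size A + m + size B + 3) = o + size A + 1 ∧
      (∀ p, o + size A + 1 < p → p < o + size A + m + 2 → f p + p = 2 * o + 2 * size A + m + 3) ∧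
      Encodes f A (o + 1) ∧ Encodes f B (o + size A + m + 3) ∧
      Encodes f t (o + size A + m + size B + 4)

theorem Encodes.congr {f g : ℕ → ℕ} {t : ArcTree} {o : ℕ} (h : Encodes f t o)
    (hfg : ∀ p, o ≤ p → p < o + size t → g p = f p) : Encodes g t o := by
  induction t generalizing o with
  | nil => trivial
  | point t ih =>
    simp only [size] at hfg
    obtain ⟨h1, h2⟩ := h
    exact ⟨by rw [hfg _ (by omega) (by omega), h1], ih h2 fun p _ _ => hfg p (by omega) (by omega)⟩
  | arc c t ihc iht =>
    simp only [size] at hfg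
    obtain ⟨h1, h2, h3, h4⟩ := h
    exact ⟨by rw [hfg _ (by omega) (by omega), h1], by rw [hfg _ (by omega) (by omega), h2],
      ihc h3 fun p _ _ => hfg p (by omega) (by omega),
      iht h4 fun p _ _ => hfg p (by omega) (by omega)⟩
  | crossing A m B t ihA ihB iht =>
    simp only [size] at hfg
    obtain ⟨h1, h2, h3, h4, h5, h6, h7, h8⟩ := h
    exact ⟨by rw [hfg _ (by omega) (by omega), h1], by rw [hfg _ (by omega) (by omega), h2],
      by rw [hfg _ (by omega) (by omega), h3], by rw [hfg _ (by omega) (by omega), h4],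
      fun p _ _ => by rw [hfg _ (by omega) (by omega)]; exact h5 p (by omega) (by omega),
      ihA h6 fun p _ _ => hfg p (by omega) (by omega),
      ihB h7 fun p _ _ => hfg p (by omega) (by omega),
      iht h8 fun p _ _ => hfg p (by omega) (by omega)⟩

theorem exists_encodes (t : ArcTree) (o : ℕ) : ∃ f, Encodes f t o := by
  induction t generalizing o with
  | nil => exact ⟨id, trivial⟩
  | point t ih =>
    obtain ⟨f, hf⟩ := ih (o + 1)
    refine ⟨fun p => if p = o then o else f p, by simp, hf.congr fun p _ _ => if_neg (by omega)⟩
  | arc c t ihc iht =>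
    obtain ⟨f, hf⟩ := ihc (o + 1)
    obtain ⟨g, hg⟩ := iht (o + size c + 2)
    refine ⟨fun p => if p = o then o + size c + 1 else if p < o + size c + 1 then f p else
      if p = o + size c + 1 then o else g p, by simp, ?_, hf.congr fun p _ _ => ?_,
      hg.congr fun p _ _ => ?_⟩
    · dsimp only; split_ifs <;> omega
    · rw [if_neg (by omega), if_pos (by omega)]
    · rw [if_neg (by omega), if_neg (by omega), if_neg (by omega)]
  | crossing A m B t ihA ihB iht =>
    obtain ⟨f, hf⟩ := ihA (o + 1)
    obtain ⟨g, hg⟩ := ihB (o + size A + m + 3)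
    obtain ⟨h, hh⟩ := iht (o + size A + m + size B + 4)
    refine ⟨fun p =>
      if p = o then o + size A + m + 2 else if p < o + size A + 1 then f p else
      if p = o + size A + 1 then o + size A + m + size B + 3 else
      if p < o + size A + m + 2 then 2 * o + 2 * size A + m + 3 - p else
      if p = o + size A + m + 2 then o else if p < o + size A + m + size B + 3 then g p else
      if p = o + size A + m + size B + 3 then o + size A + 1 else h p,
      by simp, ?_, ?_, ?_, fun p _ _ => ?_, hf.congr fun p _ _ => ?_, hg.congr fun p _ _ => ?_,
      hh.congr fun p _ _ => ?_⟩ <;> beta_reduce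
    · rw [if_neg (by omega), if_neg (by omega), if_pos rfl]
    · rw [if_neg (by omega), if_neg (by omega), if_neg (by omega), if_neg (by omega), if_pos rfl]
    · rw [if_neg (by omega), if_neg (by omega), if_neg (by omega), if_neg (by omega),
        if_neg (by omega), if_neg (by omega), if_pos rfl]
    · rw [if_neg (by omega), if_neg (by omega), if_neg (by omega), if_pos (by omega)]
      omega
    · rw [if_neg (by omega), if_pos (by omega)]
    · rw [if_neg (by omega), if_neg (by omega), if_neg (by omega), if_neg (by omega),
        if_neg (by omega), if_pos (by omega)]
    · rw [if_neg (by omega), if_neg (by omega), if_neg (by omega), if_neg (by omega),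
        if_neg (by omega), if_neg (by omega), if_neg (by omega)]

theorem Encodes.apply_mem {f : ℕ → ℕ} {t : ArcTree} {o : ℕ} (h : Encodes f t o) {p : ℕ}
    (h1 : o ≤ p) (h2 : p < o + size t) : o ≤ f p ∧ f p < o + size t := by
  induction t generalizing o with
  | nil => simp only [size] at h2; omega
  | point t ih =>
    simp only [size] at h2 ⊢
    obtain ⟨e1, e2⟩ := h
    rcases h1.eq_or_lt with rfl | h
    · omega
    · have := ih e2 (by omega) (by omega); omega
  | arc c t ihc iht =>
    simp only [size] at h2 ⊢
    obtain ⟨e1, e2, e3, e4⟩ := h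
    rcases h1.eq_or_lt with rfl | h
    · omega
    rcases lt_trichotomy p (o + size c + 1) with h | rfl | h
    · have := ihc e3 (by omega) (by omega); omega
    · omega
    · have := iht e4 (by omega) (by omega); omega
  | crossing A m B t ihA ihB iht =>
    simp only [size] at h2 ⊢
    obtain ⟨e1, e2, e3, e4, e5, e6, e7, e8⟩ := h
    rcases h1.eq_or_lt with rfl | h
    · omega
    rcases lt_trichotomy p (o + size A + 1) with h | rfl | h
    · have := ihA e6 (by omega) (by omega); omega
    · omega
    rcases lt_trichotomy p (o + size A + m + 2) with h | rfl | h
    · have := e5 p (by omega) (by omega); omega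
    · omega
    rcases lt_trichotomy p (o + size A + m + size B + 3) with h | rfl | h
    · have := ihB e7 (by omega) (by omega); omega
    · omega
    · have := iht e8 (by omega) (by omega); omega

theorem Encodes.apply_apply {f : ℕ → ℕ} {t : ArcTree} {o : ℕ} (h : Encodes f t o) {p : ℕ}
    (h1 : o ≤ p) (h2 : p < o + size t) : f (f p) = p := by
  induction t generalizing o with
  | nil => simp only [size] at h2; omega
  | point t ih =>
    simp only [size] at h2
    obtain ⟨e1, e2⟩ := h
    rcases h1.eq_or_lt with rfl | h
    · rw [e1, e1]
    · exact ih e2 (by omega) (by omega)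
  | arc c t ihc iht =>
    simp only [size] at h2
    obtain ⟨e1, e2, e3, e4⟩ := h
    rcases h1.eq_or_lt with rfl | h
    · rw [e1, e2]
    rcases lt_trichotomy p (o + size c + 1) with h | rfl | h
    · exact ihc e3 (by omega) (by omega)
    · rw [e2, e1]
    · exact iht e4 (by omega) (by omega)
  | crossing A m B t ihA ihB iht =>
    simp only [size] at h2
    obtain ⟨e1, e2, e3, e4, e5, e6, e7, e8⟩ := h
    rcases h1.eq_or_lt with rfl | h
    · rw [e1, e3]
    rcases lt_trichotomy p (o + size A + 1) with h | rfl | h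
    · exact ihA e6 (by omega) (by omega)
    · rw [e2, e4]
    rcases lt_trichotomy p (o + size A + m + 2) with h | rfl | h
    · have := e5 p (by omega) (by omega)
      have := e5 (f p) (by omega) (by omega)
      omega
    · rw [e3, e1]
    rcases lt_trichotomy p (o + size A + m + size B + 3) with h | rfl | h
    · exact ihB e7 (by omega) (by omega)
    · rw [e4, e2]
    · exact iht e8 (by omega) (by omega)

theorem Encodes.eqOn {f g : ℕ → ℕ} {t : ArcTree} {o : ℕ} (h : Encodes f t o) (h' : Encodes g t o)
    {p : ℕ} (h1 : o ≤ p) (h2 : p < o + size t) : f p = g p := by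
  induction t generalizing o with
  | nil => simp only [size] at h2; omega
  | point t ih =>
    simp only [size] at h2
    obtain ⟨e1, e2⟩ := h
    obtain ⟨e1', e2'⟩ := h'
    rcases h1.eq_or_lt with rfl | h
    · omega
    · exact ih e2 e2' (by omega) (by omega)
  | arc c t ihc iht =>
    simp only [size] at h2
    obtain ⟨e1, e2, e3, e4⟩ := h
    obtain ⟨e1', e2', e3', e4'⟩ := h'
    rcases h1.eq_or_lt with rfl | h
    · omega
    rcases lt_trichotomy p (o + size c + 1) with h | rfl | h
    · exact ihc e3 e3' (by omega) (by omega)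
    · omega
    · exact iht e4 e4' (by omega) (by omega)
  | crossing A m B t ihA ihB iht =>
    simp only [size] at h2
    obtain ⟨e1, e2, e3, e4, e5, e6, e7, e8⟩ := h
    obtain ⟨e1', e2', e3', e4', e5', e6', e7', e8'⟩ := h'
    rcases h1.eq_or_lt with rfl | h
    · omega
    rcases lt_trichotomy p (o + size A + 1) with h | rfl | h
    · exact ihA e6 e6' (by omega) (by omega)
    · omega
    rcases lt_trichotomy p (o + size A + m + 2) with h | rfl | h
    · have := e5 p (by omega) (by omega)
      have := e5' p (by omega) (by omega)
      omega
    · omega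
    rcases lt_trichotomy p (o + size A + m + size B + 3) with h | rfl | h
    · exact ihB e7 e7' (by omega) (by omega)
    · omega
    · exact iht e8 e8' (by omega) (by omega)

theorem Encodes.unique {f : ℕ → ℕ} {t t' : ArcTree} {o : ℕ} (h : Encodes f t o)
    (h' : Encodes f t' o) (hs : size t = size t') : t = t' := by
  induction t generalizing o t' with
  | nil => cases t' <;> simp only [size] at hs <;> first | rfl | omega
  | point t ih =>
    obtain ⟨e1, e2⟩ := h
    cases t' with
    | nil => simp only [size] at hs; omega
    | point t' => simp only [size] at hs; rw [ih e2 h'.2 (by omega)]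
    | arc c' t' => have := h'.1; omega
    | crossing A' m' B' t' => have := h'.1; omega
  | arc c t ihc iht =>
    obtain ⟨e1, e2, e3, e4⟩ := h
    cases t' with
    | nil => simp only [size] at hs; omega
    | point t' => have := h'.1; omega
    | arc c' t' =>
      simp only [size] at hs
      obtain ⟨e1', e2', e3', e4'⟩ := h'
      have hc : size c = size c' := by omega
      rw [ihc e3 e3' hc, iht e4 (by rwa [hc]) (by omega)]
    | crossing A' m' B' t' =>
      obtain ⟨e1', e2', -⟩ := h'
      have := e3.apply_mem (p := o + size A' + 1) (by omega) (by omega)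
      omega
  | crossing A m B t ihA ihB iht =>
    obtain ⟨e1, e2, e3, e4, e5, e6, e7, e8⟩ := h
    cases t' with
    | nil => simp only [size] at hs; omega
    | point t' => have := h'.1; omega
    | arc c' t' =>
      obtain ⟨e1', e2', e3', e4'⟩ := h'
      have := e3'.apply_mem (p := o + size A + 1) (by omega) (by omega)
      omega
    | crossing A' m' B' t' =>
      simp only [size] at hs
      obtain ⟨e1', e2', e3', e4', e5', e6', e7', e8'⟩ := h'
      -- The diagrams `A` and `A'` end just before the first letter that leaves `[o, f o]`.
      have hA : size A = size A' := by
        rcases lt_trichotomy (size A) (size A') with h | h | h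
        · have := e6'.apply_mem (p := o + size A + 1) (by omega) (by omega)
          omega
        · exact h
        · have := e6.apply_mem (p := o + size A' + 1) (by omega) (by omega)
          omega
      rw [hA] at e1 e2 e7 e8
      have hm : m = m' := by omega
      subst hm
      have hB : size B = size B' := by omega
      rw [hB] at e8
      rw [ihA e6 e6' hA, ihB e7 e7' hB, iht e8 e8' (by omega)]

end ArcTree

/-! ### Occurrences of `3412` -/

/-- The occurrences of `3412` in the restriction of `f` to `s`, as quadruples of positions. -/
def quads (f : ℕ → ℕ) (s : Finset ℕ) : Finset (ℕ × ℕ × ℕ × ℕ) :=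
  (s ×ˢ s ×ˢ s ×ˢ s).filter fun q => (q.1 < q.2.1 ∧ q.2.1 < q.2.2.1 ∧ q.2.2.1 < q.2.2.2) ∧
    f q.2.2.1 < f q.2.2.2 ∧ f q.2.2.2 < f q.1 ∧ f q.1 < f q.2.1

theorem mem_quads {f : ℕ → ℕ} {s : Finset ℕ} {p q r u : ℕ} : (p, q, r, u) ∈ quads f s ↔
    (p ∈ s ∧ q ∈ s ∧ r ∈ s ∧ u ∈ s) ∧ (p < q ∧ q < r ∧ r < u) ∧
      f r < f u ∧ f u < f p ∧ f p < f q := by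
  simp [quads]

theorem quads_mono (f : ℕ → ℕ) {s s' : Finset ℕ} (h : s ⊆ s') : quads f s ⊆ quads f s' := by
  rintro ⟨p, q, r, u⟩
  simp only [mem_quads]
  exact fun ⟨⟨h1, h2, h3, h4⟩, h5⟩ => ⟨⟨h h1, h h2, h h3, h h4⟩, h5⟩

/-- The pattern `3412` is not a direct sum, so that its occurrences in a direct sum lie in the
summands. -/
theorem card_quads_union {f : ℕ → ℕ} {s s' : Finset ℕ}
    (h : ∀ p ∈ s, ∀ q ∈ s', p < q ∧ f p < f q) :
    (quads f (s ∪ s')).card = (quads f s).card + (quads f s').card := by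
  have key : quads f (s ∪ s') = quads f s ∪ quads f s' := by
    apply Finset.Subset.antisymm
    · rintro ⟨p, q, r, u⟩
      simp only [Finset.mem_union, mem_quads]
      rintro ⟨⟨h1, h2, h3, h4⟩, h5⟩
      rcases h1 with h1 | h1
      · have h4' : u ∈ s := h4.resolve_right fun h4 => by have := h p h1 u h4; omega
        have h3' : r ∈ s := h3.resolve_right fun h3 => by have := h p h1 r h3; omega
        have h2' : q ∈ s := h2.resolve_right fun h2 => by have := h u h4' q h2; omega
        exact Or.inl ⟨⟨h1, h2', h3', h4'⟩, h5⟩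
      · have h4' : u ∈ s' := h4.resolve_left fun h4 => by have := h u h4 p h1; omega
        have h3' : r ∈ s' := h3.resolve_left fun h3 => by have := h r h3 p h1; omega
        have h2' : q ∈ s' := h2.resolve_left fun h2 => by have := h q h2 p h1; omega
        exact Or.inr ⟨⟨h1, h2', h3', h4'⟩, h5⟩
    · exact Finset.union_subset (quads_mono f Finset.subset_union_left)
        (quads_mono f Finset.subset_union_right)
  rw [key, Finset.card_union_of_disjoint]
  rw [Finset.disjoint_left]
  rintro ⟨p, q, r, u⟩
  simp only [mem_quads]
  rintro ⟨⟨h1, -⟩, -⟩ ⟨⟨h2, -⟩, -⟩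
  exact lt_irrefl _ (h p h1 p h2).1

namespace ArcTree

/-- The intervals on which `f` is encoded by consecutive diagrams form a direct sum. -/
theorem Encodes.lt_and_apply_lt {f : ℕ → ℕ} {o e : ℕ}
    (h : ∀ p, o ≤ p → p < e → o ≤ f p ∧ f p < e) {t : ArcTree} (ht : Encodes f t e) :
    ∀ p ∈ Finset.Ico o e, ∀ q ∈ Finset.Ico e (e + size t), p < q ∧ f p < f q := by
  intro p hp q hq
  rw [Finset.mem_Ico] at hp hq
  have h1 := h p hp.1 hp.2
  have h2 := ht.apply_mem hq.1 hq.2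
  omega

theorem card_quads_arc {f : ℕ → ℕ} {c : ArcTree} {o : ℕ} (e1 : f o = o + size c + 1)
    (e2 : f (o + size c + 1) = o) (e3 : Encodes f c (o + 1)) :
    quads f (Finset.Ico o (o + size c + 2)) = quads f (Finset.Ico (o + 1) (o + 1 + size c)) := by
  apply Finset.Subset.antisymm
  · rintro ⟨p, q, r, u⟩
    simp only [mem_quads, Finset.mem_Ico]
    rintro ⟨⟨h1, h2, h3, h4⟩, h5, h6⟩
    have key : ∀ z, o ≤ z → z < o + size c + 2 → z ≠ o → z ≠ o + size c + 1 →
        o + 1 ≤ f z ∧ f z < o + 1 + size c :=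
      fun z _ _ _ _ => e3.apply_mem (by omega) (by omega)
    have hp : p ≠ o := by
      rintro rfl
      rcases eq_or_ne q (p + size c + 1) with rfl | hq
      · omega
      · have := key q (by omega) (by omega) (by omega) hq
        omega
    have hu : u ≠ o + size c + 1 := by
      rintro rfl
      have := key r (by omega) (by omega) (by omega) (by omega)
      omega
    exact ⟨by omega, h5, h6⟩
  · exact quads_mono f (Finset.Ico_subset_Ico (by omega) (by omega))

/-- The shape of `f` on the letters `o = a < c < b < d` of a crossing `a - b`, `c - d` and on the
letters between them. -/
structure IsCrossing (f : ℕ → ℕ) (o a m b : ℕ) : Prop where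
  fst : f o = o + a + m + 2
  snd : f (o + a + 1) = o + a + m + b + 3
  fst' : f (o + a + m + 2) = o
  snd' : f (o + a + m + b + 3) = o + a + 1
  rev : ∀ p, o + a + 1 < p → p < o + a + m + 2 → f p + p = 2 * o + 2 * a + m + 3
  left : ∀ p, o < p → p < o + a + 1 → o < f p ∧ f p < o + a + 1
  right : ∀ p, o + a + m + 2 < p → p < o + a + m + b + 3 →
    o + a + m + 2 < f p ∧ f p < o + a + m + b + 3

theorem IsCrossing.cases {f : ℕ → ℕ} {o a m b : ℕ} (h : IsCrossing f o a m b) {z : ℕ}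
    (z1 : o ≤ z) (z2 : z < o + a + m + b + 4) : (z = o ∧ f z = o + a + m + 2) ∨
        (o < z ∧ z < o + a + 1 ∧ o < f z ∧ f z < o + a + 1) ∨
        (z = o + a + 1 ∧ f z = o + a + m + b + 3) ∨
        (o + a + 1 < z ∧ z < o + a + m + 2 ∧ f z + z = 2 * o + 2 * a + m + 3) ∨
        (z = o + a + m + 2 ∧ f z = o) ∨
        (o + a + m + 2 < z ∧ z < o + a + m + b + 3 ∧ o + a + m + 2 < f z ∧
          f z < o + a + m + b + 3) ∨
        (z = o + a + m + b + 3 ∧ f z = o + a + 1) := by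
  obtain ⟨e1, e2, e3, e4, e5, k6, k7⟩ := h
  rcases z1.eq_or_lt with rfl | z1
  · exact Or.inl ⟨rfl, e1⟩
  rcases lt_trichotomy z (o + a + 1) with h | rfl | h
  · have := k6 z (by omega) (by omega); omega
  · omega
  rcases lt_trichotomy z (o + a + m + 2) with h' | rfl | h'
  · have := e5 z (by omega) (by omega); omega
  · omega
  rcases lt_trichotomy z (o + a + m + b + 3) with h | rfl | h
  · have := k7 z (by omega) (by omega); omega
  · omega
  · omega

/-- Two crossing arcs make one occurrence of `3412`; the reversed letters under both of them belong
to none. -/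
theorem IsCrossing.quads_eq {f : ℕ → ℕ} {o a m b : ℕ} (h : IsCrossing f o a m b) :
    quads f (Finset.Ico o (o + a + m + b + 4)) =
      insert (o, o + a + 1, o + a + m + 2, o + a + m + b + 3)
        (quads f (Finset.Ico (o + 1) (o + 1 + a)) ∪
          quads f (Finset.Ico (o + a + m + 3) (o + a + m + 3 + b))) := by
  apply Finset.Subset.antisymm
  · rintro ⟨p, q, r, u⟩
    simp only [mem_quads, Finset.mem_Ico, Finset.mem_insert, Finset.mem_union, Prod.mk.injEq]
    rintro ⟨⟨h1, h2, h3, h4⟩, ⟨h5, h6, h7⟩, h8, h9, h10⟩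
    have kq := h.cases (z := q) (by omega) (by omega)
    have kr := h.cases (z := r) (by omega) (by omega)
    have ku := h.cases (z := u) (by omega) (by omega)
    rcases h.cases (z := p) (by omega) (by omega) with ⟨hp, hp'⟩ | ⟨hp, hp'⟩ | ⟨hp, hp'⟩ |
      ⟨hp, hp', hp''⟩ | ⟨hp, hp'⟩ | ⟨hp, hp'⟩ | ⟨hp, hp'⟩
    · have hq : q = o + a + 1 ∨ (o + a + m + 2 < q ∧ q < o + a + m + b + 3) := by
        clear kr ku; omega
      rcases hq with hq | hq
      · have hr : o + a + m + 2 ≤ r := by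
          rcases kr with k | k | k | k | k | k | k
          on_goal 4 => rcases ku with k' | k' | k' | k' | k' | k' | k'
          all_goals omega
        have hr' : r = o + a + m + 2 := by
          clear kq ku
          rcases kr with k | k | k | k | k | k | k <;> omega
        have hu : u = o + a + m + b + 3 := by clear kq kr; omega
        exact Or.inl ⟨hp, hq, hr', hu⟩
      · have hr : r = o + a + m + b + 3 := by clear kq ku; omega
        omega
    · have hr : o ≤ f r := by clear kq ku; omega
      have hu : u < o + a + 1 := by clear kq kr; omega
      exact Or.inr (Or.inl (by omega))
    · clear kr ku; omega
    · have hq : o + a + m + 2 < q := by clear kr ku; omega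
      clear kq ku; omega
    · clear kq kr; omega
    · have hu : u < o + a + m + b + 3 := by
        by_contra hu
        have hu : f u = o + a + 1 := by clear kq kr; omega
        clear kq ku; omega
      exact Or.inr (Or.inr (by omega))
    · clear kr ku; omega
  · obtain ⟨e1, e2, e3, e4, e5, k6, k7⟩ := h
    rw [Finset.insert_subset_iff]
    refine ⟨?_, Finset.union_subset (quads_mono f (Finset.Ico_subset_Ico (by omega) (by omega)))
      (quads_mono f (Finset.Ico_subset_Ico (by omega) (by omega)))⟩
    simp only [mem_quads, Finset.mem_Ico, e1, e2, e3, e4]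
    omega

theorem Encodes.isCrossing {f : ℕ → ℕ} {A B t : ArcTree} {m o : ℕ}
    (h : Encodes f (crossing A m B t) o) : IsCrossing f o (size A) m (size B) := by
  obtain ⟨e1, e2, e3, e4, e5, e6, e7, -⟩ := h
  refine ⟨e1, e2, e3, e4, e5, fun p _ _ => ?_, fun p _ _ => ?_⟩
  · have := e6.apply_mem (p := p) (by omega) (by omega); omega
  · have := e7.apply_mem (p := p) (by omega) (by omega); omega

/-- The occurrences of `3412` are the pairs of crossing arcs. -/
theorem Encodes.card_quads {f : ℕ → ℕ} {t : ArcTree} {o : ℕ} (h : Encodes f t o) :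
    (quads f (Finset.Ico o (o + size t))).card = crossings t := by
  induction t generalizing o with
  | nil => simp [size, crossings, quads]
  | point t ih =>
    obtain ⟨e1, e2⟩ := h
    have hs : Finset.Ico o (o + (size t + 1)) =
        Finset.Ico o (o + 1) ∪ Finset.Ico (o + 1) (o + 1 + size t) := by
      rw [Finset.Ico_union_Ico_eq_Ico (by omega) (by omega)]; congr 1; omega
    have h0 : quads f (Finset.Ico o (o + 1)) = ∅ := by
      rw [Finset.eq_empty_iff_forall_notMem]
      rintro ⟨p, q, r, u⟩
      simp only [mem_quads, Finset.mem_Ico]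
      omega
    rw [size, hs, card_quads_union, h0, ih e2, crossings, Finset.card_empty, zero_add]
    refine e2.lt_and_apply_lt fun p hp hp' => ?_
    obtain rfl : p = o := by omega
    omega
  | arc c t ihc iht =>
    obtain ⟨e1, e2, e3, e4⟩ := h
    have hs : Finset.Ico o (o + (size c + size t + 2)) =
        Finset.Ico o (o + size c + 2) ∪ Finset.Ico (o + size c + 2) (o + size c + 2 + size t) := by
      rw [Finset.Ico_union_Ico_eq_Ico (by omega) (by omega)]; congr 1; omega
    rw [size, hs, card_quads_union, card_quads_arc e1 e2 e3, ihc e3, iht e4, crossings]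
    refine e4.lt_and_apply_lt fun p hp hp' => ?_
    have : Encodes f (arc c nil) o := ⟨e1, e2, e3, trivial⟩
    simpa only [size, add_zero, add_assoc] using
      this.apply_mem hp (by simp only [size]; omega)
  | crossing A m B t ihA ihB iht =>
    have hc := h.isCrossing
    obtain ⟨e1, e2, e3, e4, e5, e6, e7, e8⟩ := h
    have hs : Finset.Ico o (o + (size A + m + size B + size t + 4)) =
        Finset.Ico o (o + size A + m + size B + 4) ∪
          Finset.Ico (o + size A + m + size B + 4) (o + size A + m + size B + 4 + size t) := by
      rw [Finset.Ico_union_Ico_eq_Ico (by omega) (by omega)]; congr 1; omega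
    rw [size, hs, card_quads_union, hc.quads_eq, Finset.card_insert_of_notMem,
      Finset.card_union_of_disjoint, ihA e6, ihB e7, iht e8, crossings]
    · omega
    · rw [Finset.disjoint_left]
      rintro ⟨p, q, r, u⟩
      simp only [mem_quads, Finset.mem_Ico]
      omega
    · simp only [Finset.mem_union, mem_quads, Finset.mem_Ico]
      omega
    · refine e8.lt_and_apply_lt fun p hp hp' => ?_
      have : Encodes f (crossing A m B nil) o := ⟨e1, e2, e3, e4, e5, e6, e7, trivial⟩
      have := this.apply_mem hp (by simp only [size]; omega)
      simp only [size] at this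
      omega

end ArcTree

/-- A decreasing map of an interval into itself reverses it. -/
theorem apply_add_self_of_decreasing {f : ℕ → ℕ} {c m : ℕ}
    (hf : ∀ p, c ≤ p → p < c + m → c ≤ f p ∧ f p < c + m)
    (hd : ∀ p q, c ≤ p → p < q → q < c + m → f q < f p) {p : ℕ} (h1 : c ≤ p) (h2 : p < c + m) :
    f p + p + 1 = 2 * c + m := by
  have up : ∀ i, i < m → f (c + i) + i + 1 ≤ c + m := by
    intro i
    induction i with
    | zero => intro hi; have := hf (c + 0) (by omega) (by omega); omega
    | succ i ih =>
      intro hi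
      have := ih (by omega)
      have := hd (c + i) (c + (i + 1)) (by omega) (by omega) (by omega)
      omega
  have down : ∀ i, ∀ q, q + i + 1 = c + m → c ≤ q → c + i ≤ f q := by
    intro i
    induction i with
    | zero => intro q hq hc; have := hf q (by omega) (by omega); omega
    | succ i ih =>
      intro q hq hc
      have := ih (q + 1) (by omega) (by omega)
      have := hd q (q + 1) (by omega) (by omega) (by omega)
      omega
  have h3 := up (p - c) (by omega)
  have h4 := down (c + m - 1 - p) p (by omega) (by omega)
  rw [show c + (p - c) = p by omega] at h3
  omega

/-- Every involution of an interval with at most one occurrence of `3412` has a diagram. If the arc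
from the first letter `o` to `b` is crossed, the crossing is the only one, and it forces the arcs
that begin between `o` and `b` to be nested as in `ArcTree.crossing`. -/
theorem exists_encodes_of_card_quads_le_one {f : ℕ → ℕ} (n : ℕ) : ∀ o : ℕ,
    (∀ p, o ≤ p → p < o + n → o ≤ f p ∧ f p < o + n) →
    (∀ p, o ≤ p → p < o + n → f (f p) = p) →
    (quads f (Finset.Ico o (o + n))).card ≤ 1 →
    ∃ t : ArcTree, t.size = n ∧ t.Encodes f o := by
  induction n using Nat.strong_induction_on with
  | _ n ih =>
  intro o hf hi hq
  -- The induction hypothesis on a subinterval that `f` preserves.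
  have sub : ∀ s l, o ≤ s → s + l ≤ o + n → l < n →
      (∀ p, s ≤ p → p < s + l → s ≤ f p ∧ f p < s + l) →
      ∃ t : ArcTree, t.size = l ∧ t.Encodes f s := fun s l hs hl hn hfl =>
    ih l hn s hfl (fun p _ _ => hi p (by omega) (by omega))
      ((Finset.card_le_card (quads_mono f (Finset.Ico_subset_Ico hs hl))).trans hq)
  rcases Nat.eq_zero_or_pos n with rfl | hn
  · exact ⟨.nil, rfl, trivial⟩
  have inj : ∀ p q, o ≤ p → p < o + n → o ≤ q → q < o + n → f p = f q → p = q := by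
    intro p q h1 h2 h3 h4 h5
    rw [← hi p h1 h2, h5, hi q h3 h4]
  obtain ⟨b, hb⟩ : ∃ b, b = f o := ⟨_, rfl⟩
  have hob := hf o le_rfl (by omega)
  have hfb : f b = o := by rw [hb, hi o le_rfl (by omega)]
  rw [← hb] at hob
  rcases hob.1.eq_or_lt with rfl | hob'
  · obtain ⟨t, ht, ht'⟩ := sub (o + 1) (n - 1) (by omega) (by omega) (by omega) (by
      intro p h1 h2
      have h3 := hf p (by omega) (by omega)
      have h4 : f p ≠ o := fun h => by
        have := inj p o (by omega) (by omega) (by omega) (by omega) (by omega)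
        omega
      omega)
    exact ⟨.point t, by simp only [ArcTree.size]; omega, hb.symm, ht'⟩
  by_cases hJ : ∀ p, o < p → p < b → f p < b
  · obtain ⟨c, hc, hc'⟩ := sub (o + 1) (b - o - 1) (by omega) (by omega) (by omega) (by
      intro p h1 h2
      have h3 := hf p (by omega) (by omega)
      have h4 : f p ≠ o := fun h => by
        have := inj p b (by omega) (by omega) (by omega) (by omega) (by omega)
        omega
      have := hJ p (by omega) (by omega)
      omega)
    obtain ⟨t, ht, ht'⟩ := sub (b + 1) (o + n - b - 1) (by omega) (by omega) (by omega) (by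
      intro p h1 h2
      have h3 := hf p (by omega) (by omega)
      have h4 := hi p (by omega) (by omega)
      have h5 : ¬ f p < b := fun h => by
        rcases h3.1.eq_or_lt with h6 | h6
        · rw [← h6] at h4; omega
        · have := hJ _ h6 h; omega
      have h6 : f p ≠ b := fun h => by rw [h] at h4; omega
      omega)
    refine ⟨.arc c t, by simp only [ArcTree.size]; omega, ?_, ?_, hc', ?_⟩
    · rw [← hb]; omega
    · rw [show o + c.size + 1 = b by omega, hfb]
    · rw [show o + c.size + 2 = b + 1 by omega]; exact ht'
  · push Not at hJ
    obtain ⟨c, hoc, hcb, hbd⟩ := hJ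
    obtain ⟨d, hd⟩ : ∃ d, d = f c := ⟨_, rfl⟩
    have hdn := hf c (by omega) (by omega)
    have hfd : f d = c := by rw [hd, hi c (by omega) (by omega)]
    rw [← hd] at hbd hdn
    have hbd' : b < d := lt_of_le_of_ne hbd (by rintro rfl; omega)
    have uniq : ∀ p q r u, o ≤ p → p < q → q < r → r < u → u < o + n → f r < f u → f u < f p →
        f p < f q → p = o ∧ q = c ∧ r = b ∧ u = d := by
      intro p q r u h1 h2 h3 h4 h5 h6 h7 h8
      have := Finset.card_le_one.1 hq (p, q, r, u)
        (by simp only [mem_quads, Finset.mem_Ico]; omega) (o, c, b, d)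
        (by simp only [mem_quads, Finset.mem_Ico]; omega)
      simpa only [Prod.mk.injEq] using this
    have cross : ∀ p q, o ≤ p → p < q → q < f p → f p < f q → f q < o + n → p = o ∧ q = c := by
      intro p q h1 h2 h3 h4 h5
      have i1 := hi p (by omega) (by omega)
      have i2 := hi q (by omega) (by omega)
      have := uniq p q (f p) (f q) h1 h2 h3 h4 h5 (by omega) (by omega) h4
      exact ⟨this.1, this.2.1⟩
    -- No other letter before `d` is an end of one of the two crossing arcs.
    have off : ∀ p, o ≤ p → p < o + n → p ≠ o → p ≠ b → p ≠ c → p ≠ d →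
        f p ≠ o ∧ f p ≠ b ∧ f p ≠ c ∧ f p ≠ d := by
      intro p h1 h2 h3 h4 h5 h6
      have := hi p h1 h2
      refine ⟨?_, ?_, ?_, ?_⟩ <;> intro h <;> rw [h] at this <;> omega
    have hA : ∀ p, o < p → p < c → o < f p ∧ f p < c := by
      intro p h1 h2
      have i1 := hf p (by omega) (by omega)
      have i2 := off p (by omega) (by omega) (by omega) (by omega) (by omega) (by omega)
      have h3 : ¬ b < f p := fun h => by
        have := cross o p le_rfl h1 (by omega) (by omega) (by omega)
        omega
      have h4 : ¬ c < f p := fun h => by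
        have := cross p c (by omega) h2 h (by omega) (by omega)
        omega
      omega
    have hM : ∀ p, c < p → p < b → c < f p ∧ f p < b := by
      intro p h1 h2
      have i1 := hf p (by omega) (by omega)
      have i2 := off p (by omega) (by omega) (by omega) (by omega) (by omega) (by omega)
      have i3 := hi p (by omega) (by omega)
      have h3 : ¬ b < f p := fun h => by
        have := cross o p le_rfl (by omega) (by omega) (by omega) (by omega)
        omega
      have h4 : ¬ f p < c := fun h => by
        have := hA (f p) (by omega) h
        omega
      omega
    have hM' : ∀ p q, c < p → p < q → q < b → f q < f p := by
      intro p q h1 h2 h3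
      have i1 := hM p h1 (by omega)
      have i2 := hM q (by omega) h3
      by_contra h
      have h4 : f p ≠ f q := fun h => by
        have := inj p q (by omega) (by omega) (by omega) (by omega) h
        omega
      have := uniq o c p q le_rfl hoc h1 h2 (by omega) (by omega) (by omega) (by omega)
      omega
    have hB : ∀ p, b < p → p < d → b < f p ∧ f p < d := by
      intro p h1 h2
      have i1 := hf p (by omega) (by omega)
      have i2 := off p (by omega) (by omega) (by omega) (by omega) (by omega) (by omega)
      have i3 := hi p (by omega) (by omega)
      have h3 : ¬ f p < c := fun h => by
        have := hA (f p) (by omega) h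
        omega
      have h4 : ¬ f p < b := fun h => by
        have := hM (f p) (by omega) h
        omega
      have h5 : ¬ d < f p := fun h => by
        have := cross c p (by omega) (by omega) (by omega) (by omega) (by omega)
        omega
      omega
    obtain ⟨A, sA, eA⟩ := sub (o + 1) (c - o - 1) (by omega) (by omega) (by omega)
      fun p _ _ => by have := hA p (by omega) (by omega); omega
    obtain ⟨B, sB, eB⟩ := sub (b + 1) (d - b - 1) (by omega) (by omega) (by omega)
      fun p _ _ => by have := hB p (by omega) (by omega); omega
    obtain ⟨t, st, et⟩ := sub (d + 1) (o + n - d - 1) (by omega) (by omega) (by omega) (by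
      intro p h1 h2
      have i1 := hf p (by omega) (by omega)
      have i2 := off p (by omega) (by omega) (by omega) (by omega) (by omega) (by omega)
      have i3 := hi p (by omega) (by omega)
      have h3 : ¬ f p < c := fun h => by
        have := hA (f p) (by omega) h
        omega
      have h4 : ¬ f p < b := fun h => by
        have := hM (f p) (by omega) h
        omega
      have h5 : ¬ f p < d := fun h => by
        have := hB (f p) (by omega) h
        omega
      omega)
    refine ⟨.crossing A (b - c - 1) B t, by simp only [ArcTree.size]; omega, ?_, ?_, ?_, ?_,
      fun p h1 h2 => ?_, eA, ?_, ?_⟩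
    · rw [← hb]; omega
    · rw [show o + A.size + 1 = c by omega, ← hd]; omega
    · rw [show o + A.size + (b - c - 1) + 2 = b by omega, hfb]
    · rw [show o + A.size + (b - c - 1) + B.size + 3 = d by omega, hfd]; omega
    · have := apply_add_self_of_decreasing (f := f) (c := c + 1) (m := b - c - 1)
        (fun p _ _ => by have := hM p (by omega) (by omega); omega)
        (fun p q _ _ _ => hM' p q (by omega) (by omega) (by omega)) (p := p) (by omega) (by omega)
      omega
    · rw [show o + A.size + (b - c - 1) + 3 = b + 1 by omega]; exact eB
    · rw [show o + A.size + (b - c - 1) + B.size + 4 = d + 1 by omega]; exact et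

/-! ### Decreasing subsequences -/

/-- The `k`-element subsets of `s` on which `f` is strictly decreasing, that is, the occurrences of
`k ⋯ 2 1` in the restriction of `f` to `s`. -/
noncomputable def decSets (f : ℕ → ℕ) (s : Finset ℕ) (k : ℕ) : Finset (Finset ℕ) :=
  open scoped Classical in (s.powersetCard k).filter fun S => StrictAntiOn f (S : Set ℕ)

theorem mem_decSets {f : ℕ → ℕ} {s S : Finset ℕ} {k : ℕ} : S ∈ decSets f s k ↔
    S ⊆ s ∧ S.card = k ∧ ∀ p ∈ S, ∀ q ∈ S, p < q → f q < f p := by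
  simp only [decSets, Finset.mem_filter, Finset.mem_powersetCard, StrictAntiOn, Finset.mem_coe,
    and_assoc]

theorem decSets_mono (f : ℕ → ℕ) {s s' : Finset ℕ} (h : s ⊆ s') (k : ℕ) :
    decSets f s k ⊆ decSets f s' k := fun S hS => by
  rw [mem_decSets] at hS ⊢
  exact ⟨hS.1.trans h, hS.2⟩

/-- The number of decreasing subsequences of length `k` in a union is the sum of the numbers in the
two parts, if no such subsequence meets both. -/
theorem card_decSets_eq_add {f : ℕ → ℕ} {s s₁ s₂ : Finset ℕ} {k : ℕ} (h₁ : s₁ ⊆ s) (h₂ : s₂ ⊆ s)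
    (hk : k ≠ 0) (hd : Disjoint s₁ s₂) (h : ∀ S ∈ decSets f s k, S ⊆ s₁ ∨ S ⊆ s₂) :
    (decSets f s k).card = (decSets f s₁ k).card + (decSets f s₂ k).card := by
  classical
  have key : decSets f s k = decSets f s₁ k ∪ decSets f s₂ k := by
    apply Finset.Subset.antisymm
    · intro S hS
      have := h S hS
      simp only [Finset.mem_union, mem_decSets] at hS ⊢
      exact this.imp (fun h => ⟨h, hS.2⟩) fun h => ⟨h, hS.2⟩
    · exact Finset.union_subset (decSets_mono f h₁ k) (decSets_mono f h₂ k)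
  rw [key, Finset.card_union_of_disjoint]
  rw [Finset.disjoint_left]
  intro S hS hS'
  rw [mem_decSets] at hS hS'
  have : S = ∅ := Finset.subset_empty.1 (by
    have := Finset.subset_inter hS.1 hS'.1
    rwa [Finset.disjoint_iff_inter_eq_empty.1 hd] at this)
  rw [this, Finset.card_empty] at hS
  exact hk hS.2.1.symm

theorem card_decSets_union {f : ℕ → ℕ} {s s' : Finset ℕ}
    (h : ∀ p ∈ s, ∀ q ∈ s', p < q ∧ f p < f q) {k : ℕ} (hk : k ≠ 0) :
    (decSets f (s ∪ s') k).card = (decSets f s k).card + (decSets f s' k).card := by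
  refine card_decSets_eq_add Finset.subset_union_left Finset.subset_union_right hk ?_ ?_
  · rw [Finset.disjoint_left]
    intro p hp hp'
    exact lt_irrefl _ (h p hp p hp').1
  · intro S hS
    rw [mem_decSets] at hS
    by_contra! hc
    obtain ⟨⟨p, hp, hp'⟩, q, hq, hq'⟩ := And.imp Finset.not_subset.1 Finset.not_subset.1 hc
    have h1 := (Finset.mem_union.1 (hS.1 hp)).resolve_left hp'
    have h2 := (Finset.mem_union.1 (hS.1 hq)).resolve_right hq'
    have := h q h2 p h1
    have := hS.2.2 q hq p hp this.1
    omega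

theorem decSets_zero (f : ℕ → ℕ) (s : Finset ℕ) : (decSets f s 0).card = 1 := by
  rw [Finset.card_eq_one]
  refine ⟨∅, ?_⟩
  ext S
  rw [mem_decSets, Finset.mem_singleton]
  constructor
  · exact fun h => Finset.card_eq_zero.1 h.2.1
  · rintro rfl; simp

theorem decSets_one (f : ℕ → ℕ) (s : Finset ℕ) : (decSets f s 1).card = s.card := by
  have : decSets f s 1 = s.powersetCard 1 := by
    ext S
    rw [mem_decSets, Finset.mem_powersetCard, ← and_assoc, and_iff_left_iff_imp]
    rintro ⟨-, h⟩ p hp q hq hpq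
    have := Finset.card_le_one.1 h.le p hp q hq
    omega
  rw [this, Finset.card_powersetCard, Nat.choose_one_right]

/-- A set without decreasing subsequences of length `k` has none of length `k + 1`. -/
theorem card_decSets_succ_eq_zero {f : ℕ → ℕ} {s : Finset ℕ} {k : ℕ}
    (h : (decSets f s k).card = 0) : (decSets f s (k + 1)).card = 0 := by
  rw [Finset.card_eq_zero, Finset.eq_empty_iff_forall_notMem] at h ⊢
  intro S hS
  rw [mem_decSets] at hS
  obtain ⟨a, ha⟩ : S.Nonempty := Finset.card_pos.1 (by omega)
  refine h (S.erase a) (mem_decSets.2 ⟨(Finset.erase_subset _ _).trans hS.1, ?_, ?_⟩)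
  · rw [Finset.card_erase_of_mem ha, hS.2.1]; omega
  · exact fun p hp q hq => hS.2.2 p (Finset.mem_of_mem_erase hp) q (Finset.mem_of_mem_erase hq)

theorem card_decSets_eq_zero_of_le {f : ℕ → ℕ} {s : Finset ℕ} {k l : ℕ}
    (h : (decSets f s k).card = 0) (hkl : k ≤ l) : (decSets f s l).card = 0 := by
  induction l, hkl using Nat.le_induction with
  | base => exact h
  | succ l _ ih => exact card_decSets_succ_eq_zero ih

/-- A decreasing subsequence of length `k ≥ 1` that is unique is also longest: one of length `k + 1`
would contain several of length `k`. -/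
theorem card_decSets_succ_eq_zero_of_eq_one {f : ℕ → ℕ} {s : Finset ℕ} {k : ℕ} (hk : 1 ≤ k)
    (h : (decSets f s k).card = 1) : (decSets f s (k + 1)).card = 0 := by
  rw [Finset.card_eq_zero, Finset.eq_empty_iff_forall_notMem]
  intro S hS
  rw [mem_decSets] at hS
  obtain ⟨a, ha, b, hb, hab⟩ := Finset.one_lt_card.1 (show 1 < S.card by omega)
  have key : ∀ c ∈ S, S.erase c ∈ decSets f s k := fun c hc =>
    mem_decSets.2 ⟨(Finset.erase_subset _ _).trans hS.1,
      by rw [Finset.card_erase_of_mem hc, hS.2.1]; omega,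
      fun p hp q hq => hS.2.2 p (Finset.mem_of_mem_erase hp) q (Finset.mem_of_mem_erase hq)⟩
  have := Finset.card_le_one.1 h.le _ (key a ha) _ (key b hb)
  exact Finset.notMem_erase a S (this ▸ Finset.mem_erase.2 ⟨hab, ha⟩)

section Arc

variable {f : ℕ → ℕ} {s : Finset ℕ} {a b : ℕ}

theorem insert_insert_mem_decSets (ha : f a = b) (hb : f b = a)
    (hab : a < b) (hs : ∀ p ∈ s, a < p ∧ p < b ∧ a < f p ∧ f p < b) {k : ℕ} {S : Finset ℕ}
    (hS : S ∈ decSets f s k) :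
    insert a (insert b S) ∈ decSets f (insert a (insert b s)) (k + 2) := by
  rw [mem_decSets] at hS ⊢
  have h1 : b ∉ S := fun h => by have := hs b (hS.1 h); omega
  have h2 : a ∉ insert b S := fun h => by
    rcases Finset.mem_insert.1 h with h | h
    · omega
    · have := hs a (hS.1 h); omega
  refine ⟨Finset.insert_subset_insert _ (Finset.insert_subset_insert _ hS.1), ?_, ?_⟩
  · rw [Finset.card_insert_of_notMem h2, Finset.card_insert_of_notMem h1, hS.2.1]
  · have key : ∀ p ∈ S, a < p ∧ p < b ∧ a < f p ∧ f p < b := fun p hp => hs p (hS.1 hp)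
    intro p hp q hq hpq
    simp only [Finset.mem_insert] at hp hq
    rcases hp with rfl | rfl | hp
    · rcases hq with rfl | rfl | hq
      · omega
      · omega
      · have := key q hq; omega
    · rcases hq with rfl | rfl | hq
      · omega
      · omega
      · have := key q hq; omega
    · rcases hq with rfl | rfl | hq
      · have := key p hp; omega
      · have := key p hp; omega
      · exact hS.2.2 p hp q hq hpq

theorem erase_erase_mem_decSets {k : ℕ} {S : Finset ℕ}
    (hS : S ∈ decSets f (insert a (insert b s)) k) :
    (S.erase a).erase b ∈ decSets f s ((S.erase a).erase b).card := by
  rw [mem_decSets] at hS ⊢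
  refine ⟨fun p hp => ?_, rfl, fun p hp q hq => hS.2.2 p ?_ q ?_⟩
  · simp only [Finset.mem_erase] at hp
    have := hS.1 hp.2.2
    simp only [Finset.mem_insert] at this
    tauto
  · exact Finset.mem_of_mem_erase (Finset.mem_of_mem_erase hp)
  · exact Finset.mem_of_mem_erase (Finset.mem_of_mem_erase hq)

theorem card_decSets_arc_eq_zero_iff (ha : f a = b) (hb : f b = a)
    (hab : a < b) (hs : ∀ p ∈ s, a < p ∧ p < b ∧ a < f p ∧ f p < b) (k : ℕ) :
    (decSets f (insert a (insert b s)) (k + 2)).card = 0 ↔ (decSets f s k).card = 0 := by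
  constructor
  · intro h
    rw [Finset.card_eq_zero, Finset.eq_empty_iff_forall_notMem] at h ⊢
    exact fun S hS => h _ (insert_insert_mem_decSets ha hb hab hs hS)
  · intro h
    rw [Finset.card_eq_zero, Finset.eq_empty_iff_forall_notMem]
    intro S hS
    have h1 := erase_erase_mem_decSets hS
    have h2 : k ≤ ((S.erase a).erase b).card := by
      have h3 := Finset.pred_card_le_card_erase (s := S) (a := a)
      have h4 := Finset.pred_card_le_card_erase (s := S.erase a) (a := b)
      have := (mem_decSets.1 hS).2.1
      omega
    have := card_decSets_eq_zero_of_le h h2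
    rw [Finset.card_eq_zero, Finset.eq_empty_iff_forall_notMem] at this
    exact this _ h1

/-- If no decreasing subsequence inside the arc from `a` to `b` has length `k + 1`, then each of
length `k + 2` in all contains both ends of the arc. -/
theorem card_decSets_arc (ha : f a = b) (hb : f b = a)
    (hab : a < b) (hs : ∀ p ∈ s, a < p ∧ p < b ∧ a < f p ∧ f p < b) {k : ℕ}
    (h : (decSets f s (k + 1)).card = 0) :
    (decSets f (insert a (insert b s)) (k + 2)).card = (decSets f s k).card := by
  symm
  have hns : ∀ S ∈ decSets f s k, a ∉ S ∧ b ∉ S := fun S hS =>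
    ⟨fun h => by have := hs a ((mem_decSets.1 hS).1 h); omega,
      fun h => by have := hs b ((mem_decSets.1 hS).1 h); omega⟩
  refine Finset.card_bij (fun S _ => insert a (insert b S))
    (fun S hS => insert_insert_mem_decSets ha hb hab hs hS) ?_ ?_
  · intro S hS S' hS' h
    ext p
    have := congrArg (fun T => p ∈ T) h
    simp only [Finset.mem_insert, eq_iff_iff] at this
    have h1 := hns S hS
    have h2 := hns S' hS'
    constructor
    · intro hp
      rcases this.1 (Or.inr (Or.inr hp)) with rfl | rfl | h
      · exact absurd hp h1.1
      · exact absurd hp h1.2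
      · exact h
    · intro hp
      rcases this.2 (Or.inr (Or.inr hp)) with rfl | rfl | h
      · exact absurd hp h2.1
      · exact absurd hp h2.2
      · exact h
  · intro S hS
    have h1 := erase_erase_mem_decSets hS
    have h0 := (mem_decSets.1 hS).2.1
    have h2 : ((S.erase a).erase b).card ≤ k := by
      by_contra h2
      have := card_decSets_eq_zero_of_le h (l := ((S.erase a).erase b).card) (by omega)
      rw [Finset.card_eq_zero, Finset.eq_empty_iff_forall_notMem] at this
      exact this _ h1
    have h3 := Finset.pred_card_le_card_erase (s := S) (a := a)
    have h4 := Finset.pred_card_le_card_erase (s := S.erase a) (a := b)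
    have ha : a ∈ S := by
      by_contra h
      rw [Finset.erase_eq_of_notMem h] at h2 h4
      omega
    rw [Finset.card_erase_of_mem ha] at h4
    have hb : b ∈ S.erase a := by
      by_contra h
      rw [Finset.erase_eq_of_notMem h, Finset.card_erase_of_mem ha] at h2
      omega
    have h5 : ((S.erase a).erase b).card = k := by omega
    rw [h5] at h1
    exact ⟨_, h1, by rw [Finset.insert_erase hb, Finset.insert_erase ha]⟩

end Arc

namespace ArcTree

variable {f : ℕ → ℕ} {o a m b : ℕ}

/-- The letters of a crossing which lie on or under its first arc, those between the arcs
excluded. -/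
def leftPart (o a m : ℕ) : Finset ℕ :=
  insert o (insert (o + a + m + 2) (Finset.Ico (o + 1) (o + 1 + a)))

/-- The letters of a crossing which lie on or under its second arc, those between the arcs
excluded. -/
def rightPart (o a m b : ℕ) : Finset ℕ :=
  insert (o + a + 1) (insert (o + a + m + b + 3)
    (Finset.Ico (o + a + m + 3) (o + a + m + 3 + b)))

/-- If fewer than `k` letters lie under both arcs of a crossing, then a decreasing subsequence of
length `k + 2` stays on one side. -/
theorem IsCrossing.card_decSets (h : IsCrossing f o a m b) {k : ℕ} (hmk : m < k) :
    (decSets f (Finset.Ico o (o + a + m + b + 4)) (k + 2)).card =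
      (decSets f (leftPart o a m) (k + 2)).card +
        (decSets f (rightPart o a m b) (k + 2)).card := by
  refine card_decSets_eq_add ?_ ?_ (by omega) ?_ ?_
  · intro p
    simp only [leftPart, Finset.mem_insert, Finset.mem_Ico]
    omega
  · intro p
    simp only [rightPart, Finset.mem_insert, Finset.mem_Ico]
    omega
  · rw [Finset.disjoint_left]
    intro p
    simp only [leftPart, rightPart, Finset.mem_insert, Finset.mem_Ico]
    omega
  · intro S hS
    rw [mem_decSets] at hS
    obtain ⟨hS, hc, hd⟩ := hS
    have hS' : ∀ p ∈ S, o ≤ p ∧ p < o + a + m + b + 4 := fun p hp => Finset.mem_Ico.1 (hS hp)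
    by_cases hA : ∃ p ∈ S, o < p ∧ p < o + a + 1
    · left
      obtain ⟨p, hp, hp1, hp2⟩ := hA
      have hfp := h.left p hp1 hp2
      intro q hq
      have h1 := hd p hp q hq
      have h2 := h.cases (hS' q hq).1 (hS' q hq).2
      simp only [leftPart, Finset.mem_insert, Finset.mem_Ico]
      omega
    by_cases hB : ∃ p ∈ S, o + a + m + 2 < p ∧ p < o + a + m + b + 3
    · right
      obtain ⟨p, hp, hp1, hp2⟩ := hB
      have hfp := h.right p hp1 hp2
      intro q hq
      have h1 := hd q hq p hp
      have h2 := h.cases (hS' q hq).1 (hS' q hq).2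
      simp only [rightPart, Finset.mem_insert, Finset.mem_Ico]
      omega
    -- Now `S` has at most one left end and at most one right end, hence at most `m + 2` elements.
    exfalso
    push Not at hA hB
    have h1 : ¬ (o ∈ S ∧ o + a + 1 ∈ S) := fun ⟨h1, h2⟩ => by
      have := hd _ h1 _ h2 (by omega)
      rw [h.fst, h.snd] at this
      omega
    have h2 : ¬ (o + a + m + 2 ∈ S ∧ o + a + m + b + 3 ∈ S) := fun ⟨h1, h2⟩ => by
      have := hd _ h1 _ h2 (by omega)
      rw [h.fst', h.snd'] at this
      omega
    have h3 : S ⊆ insert (if o ∈ S then o else o + a + 1)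
        (insert (if o + a + m + 2 ∈ S then o + a + m + 2 else o + a + m + b + 3)
          (Finset.Ico (o + a + 2) (o + a + 2 + m))) := by
      intro q hq
      have h4 := hA q hq
      have h5 := hB q hq
      have h6 := hS' q hq
      simp only [Finset.mem_insert, Finset.mem_Ico]
      by_cases e1 : q = o
      · subst e1; rw [if_pos hq]; exact Or.inl rfl
      by_cases e2 : q = o + a + m + 2
      · subst e2; rw [if_pos hq]; exact Or.inr (Or.inl rfl)
      by_cases e3 : q = o + a + 1
      · subst e3; rw [if_neg fun h => h1 ⟨h, hq⟩]; exact Or.inl rfl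
      by_cases e4 : q = o + a + m + b + 3
      · subst e4; rw [if_neg fun h => h2 ⟨h, hq⟩]; exact Or.inr (Or.inl rfl)
      omega
    have h4 := Finset.card_le_card h3
    have h5 := Finset.card_insert_le (if o ∈ S then o else o + a + 1)
        (insert (if o + a + m + 2 ∈ S then o + a + m + 2 else o + a + m + b + 3)
          (Finset.Ico (o + a + 2) (o + a + 2 + m)))
    have h6 := Finset.card_insert_le
        (if o + a + m + 2 ∈ S then o + a + m + 2 else o + a + m + b + 3)
          (Finset.Ico (o + a + 2) (o + a + 2 + m))
    rw [Nat.card_Ico] at h6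
    omega

/-- If at least `k` letters lie under both arcs of a crossing, then they extend by the ends of
either arc to decreasing subsequences of length `k + 2`. -/
theorem IsCrossing.one_lt_card_decSets (h : IsCrossing f o a m b) {k : ℕ} (hmk : k ≤ m) :
    1 < (decSets f (Finset.Ico o (o + a + m + b + 4)) (k + 2)).card := by
  have key : ∀ u v, u ∈ Finset.Ico o (o + a + 2) → v ∈ Finset.Ico (o + a + m + 2)
      (o + a + m + b + 4) → o + a + m + 2 ≤ f u → f v ≤ o + a + 1 →
      insert u (insert v (Finset.Ico (o + a + 2) (o + a + 2 + k))) ∈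
        decSets f (Finset.Ico o (o + a + m + b + 4)) (k + 2) := by
    intro u v hu hv hfu hfv
    rw [Finset.mem_Ico] at hu hv
    rw [mem_decSets]
    refine ⟨?_, ?_, ?_⟩
    · intro p
      simp only [Finset.mem_insert, Finset.mem_Ico]
      omega
    · rw [Finset.card_insert_of_notMem, Finset.card_insert_of_notMem, Nat.card_Ico]
      · omega
      · simp only [Finset.mem_Ico]; omega
      · simp only [Finset.mem_insert, Finset.mem_Ico]; omega
    · intro p hp q hq hpq
      simp only [Finset.mem_insert, Finset.mem_Ico] at hp hq
      rcases hp with rfl | rfl | hp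
      · rcases hq with rfl | rfl | hq
        · omega
        · omega
        · have := h.rev q (by omega) (by omega); omega
      · rcases hq with rfl | rfl | hq <;> omega
      · rcases hq with rfl | rfl | hq
        · omega
        · have := h.rev p (by omega) (by omega); omega
        · have := h.rev p (by omega) (by omega)
          have := h.rev q (by omega) (by omega)
          omega
  have e1 := h.fst
  have e2 := h.snd
  have e3 := h.fst'
  have e4 := h.snd'
  refine Finset.one_lt_card.2
    ⟨_, key o (o + a + m + 2) (Finset.mem_Ico.2 (by omega)) (Finset.mem_Ico.2 (by omega))
        (by omega) (by omega),
      _, key (o + a + 1) (o + a + m + b + 3) (Finset.mem_Ico.2 (by omega))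
        (Finset.mem_Ico.2 (by omega)) (by omega) (by omega), ?_⟩
  intro he
  have := he ▸ Finset.mem_insert_self o _
  simp only [Finset.mem_insert, Finset.mem_Ico] at this
  omega

end ArcTree

/-! ### Decreasing subsequences of a diagram -/

/-- The indicator of `n = 0`. -/
def indZero (n : ℕ) : ℚ := if n = 0 then 1 else 0

/-- The indicator of `n = 1` and `n' = 0`. -/
def indOne (n n' : ℕ) : ℚ := if n = 1 ∧ n' = 0 then 1 else 0

theorem indZero_add (x y : ℕ) : indZero (x + y) = indZero x * indZero y := by
  unfold indZero
  split_ifs <;> first | omega | simp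

theorem indOne_add {x x' y y' : ℕ} (hx : x = 0 → x' = 0) (hy : y = 0 → y' = 0) :
    indOne (x + y) (x' + y') = indOne x x' * indZero y + indZero x * indOne y y' := by
  unfold indOne indZero
  split_ifs <;> first | omega | simp

namespace ArcTree

/-- The indicator that the involution with diagram `t` has no decreasing subsequence of
length `k`, by recursion: an arc lengthens by two the longest decreasing subsequence of what it
encloses. -/
def avoid : ArcTree → ℕ → ℚ
  | _, 0 => 0
  | nil, _ + 1 => 1
  | point _, 1 => 0
  | arc _ _, 1 => 0
  | crossing _ _ _ _, 1 => 0
  | point t, k + 2 => avoid t (k + 2)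
  | arc c t, k + 2 => avoid c k * avoid t (k + 2)
  | crossing A m B t, k + 2 => if m < k then avoid A k * avoid B k * avoid t (k + 2) else 0

/-- The indicator that the involution with diagram `t` has one decreasing subsequence of
length `k` and none of length `k + 1`. For `k ≥ 1` the second condition follows from the first; with
it the recursion is valid from `k = 0` on. -/
def once : ArcTree → ℕ → ℚ
  | nil, 0 => 1
  | point _, 0 => 0
  | arc _ _, 0 => 0
  | crossing _ _ _ _, 0 => 0
  | nil, _ + 1 => 0
  | point nil, 1 => 1
  | point (point _), 1 => 0
  | point (arc _ _), 1 => 0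
  | point (crossing _ _ _ _), 1 => 0
  | arc _ _, 1 => 0
  | crossing _ _ _ _, 1 => 0
  | point t, k + 2 => once t (k + 2)
  | arc c t, k + 2 => once c k * avoid t (k + 2) + avoid c k * once t (k + 2)
  | crossing A m B t, k + 2 => if m < k then
      (once A k * avoid B k + avoid A k * once B k) * avoid t (k + 2) +
        avoid A k * avoid B k * once t (k + 2) else 0

theorem avoid_one (t : ArcTree) : avoid t 1 = indZero (size t) := by
  cases t <;> simp [avoid, indZero, size]

theorem once_zero (t : ArcTree) : once t 0 = indZero (size t) := by
  cases t <;> simp [once, indZero, size]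

theorem once_one (t : ArcTree) : once t 1 = indOne (size t) 0 := by
  rcases t with _ | (_ | _ | _ | _) | _ | _ <;> simp [once, indOne, size]

/-- The number of decreasing subsequences of length `k` of `f` on `[o, e)`. -/
noncomputable def numDec (f : ℕ → ℕ) (o e k : ℕ) : ℕ := (decSets f (Finset.Ico o e) k).card

theorem numDec_succ_eq_zero {f : ℕ → ℕ} {o e k : ℕ} (h : numDec f o e k = 0) :
    numDec f o e (k + 1) = 0 := card_decSets_succ_eq_zero h

theorem numDec_append {f : ℕ → ℕ} {o e : ℕ} (hoe : o ≤ e)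
    (h : ∀ p, o ≤ p → p < e → o ≤ f p ∧ f p < e) {t : ArcTree} (ht : Encodes f t e) {k : ℕ}
    (hk : k ≠ 0) : numDec f o (e + size t) k = numDec f o e k + numDec f e (e + size t) k := by
  rw [numDec, ← Finset.Ico_union_Ico_eq_Ico hoe (Nat.le_add_right e (size t)),
    card_decSets_union (ht.lt_and_apply_lt h) hk]
  rfl

/-- Adding an arc over `c` turns decreasing subsequences of length `k` into those of length `k + 2`,
as far as having none, or exactly one and no longer one, is concerned. -/
theorem arc_indicators {f : ℕ → ℕ} {o a b k : ℕ} {c : ArcTree} (ha : f a = b) (hb : f b = a)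
    (hao : a < o) (hob : o + size c ≤ b) (hc : Encodes f c o) :
    indZero (decSets f (insert a (insert b (Finset.Ico o (o + size c)))) (k + 2)).card =
        indZero (numDec f o (o + size c) k) ∧
      indOne (decSets f (insert a (insert b (Finset.Ico o (o + size c)))) (k + 2)).card
        (decSets f (insert a (insert b (Finset.Ico o (o + size c)))) (k + 2 + 1)).card =
        indOne (numDec f o (o + size c) k) (numDec f o (o + size c) (k + 1)) := by
  have hs : ∀ p ∈ Finset.Ico o (o + size c), a < p ∧ p < b ∧ a < f p ∧ f p < b := by
    intro p hp
    rw [Finset.mem_Ico] at hp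
    have := hc.apply_mem hp.1 hp.2
    omega
  have h0 := card_decSets_arc_eq_zero_iff ha hb (by omega) hs k
  have h1 := card_decSets_arc_eq_zero_iff ha hb (by omega) hs (k + 1)
  have h2 := card_decSets_arc (k := k) ha hb (by omega) hs
  unfold indZero indOne numDec
  constructor
  · simp only [h0]
  · congr 1
    rw [eq_iff_iff]
    constructor
    · rintro ⟨h3, h4⟩
      have h5 := h1.1 h4
      exact ⟨by rw [← h2 h5, h3], h5⟩
    · rintro ⟨h3, h4⟩
      exact ⟨by rw [h2 h4, h3], h1.2 h4⟩

theorem avoid_and_once_of_lt_two (f : ℕ → ℕ) (t : ArcTree) (o : ℕ) {k : ℕ} (hk : k < 2) :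
    avoid t k = indZero (numDec f o (o + size t) k) ∧
      once t k = indOne (numDec f o (o + size t) k) (numDec f o (o + size t) (k + 1)) := by
  have hs : numDec f o (o + size t) 1 = size t := by
    rw [numDec, decSets_one, Nat.card_Ico, Nat.add_sub_cancel_left]
  obtain rfl | rfl : k = 0 ∨ k = 1 := by omega
  · rw [zero_add, hs, numDec, decSets_zero, once_zero]
    cases t <;> simp [avoid, indZero, indOne]
  · rw [hs, avoid_one, once_one]
    refine ⟨rfl, ?_⟩
    unfold indOne
    congr 1
    rw [eq_iff_iff]
    refine and_congr_right fun h => ?_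
    rw [← hs] at h
    exact (iff_of_true rfl (card_decSets_succ_eq_zero_of_eq_one le_rfl h))

/-- The recursive weights `avoid` and `once` are the indicators which they are named for. -/
theorem Encodes.avoid_and_once {f : ℕ → ℕ} {t : ArcTree} {o : ℕ} (h : Encodes f t o) (k : ℕ) :
    avoid t k = indZero (numDec f o (o + size t) k) ∧
      once t k = indOne (numDec f o (o + size t) k) (numDec f o (o + size t) (k + 1)) := by
  induction t generalizing o k with
  | nil =>
    rcases lt_or_ge k 2 with hk | hk
    · exact avoid_and_once_of_lt_two f _ o hk
    obtain ⟨k, rfl⟩ := Nat.exists_eq_add_of_le' hk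
    have : ∀ l, numDec f o (o + size nil) (l + 1) = 0 := by
      intro l
      rw [numDec, Finset.card_eq_zero, Finset.eq_empty_iff_forall_notMem]
      intro S hS
      rw [mem_decSets, size, add_zero, Finset.Ico_self, Finset.subset_empty] at hS
      obtain ⟨rfl, h, -⟩ := hS
      simp at h
    rw [this (k + 1), this (k + 2)]
    simp [avoid, once, indZero, indOne]
  | point t ih =>
    rcases lt_or_ge k 2 with hk | hk
    · exact avoid_and_once_of_lt_two f _ o hk
    obtain ⟨k, rfl⟩ := Nat.exists_eq_add_of_le' hk
    obtain ⟨e1, e2⟩ := h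
    have key : ∀ l, numDec f o (o + size (point t)) (l + 2) =
        numDec f (o + 1) (o + 1 + size t) (l + 2) := by
      intro l
      rw [size, show o + (size t + 1) = o + 1 + size t by omega, numDec_append (by omega)
        (fun p _ _ => by obtain rfl : p = o := by omega
                         omega) e2 (by omega), add_eq_right, numDec, Finset.card_eq_zero,
        Finset.eq_empty_iff_forall_notMem]
      intro S hS
      rw [mem_decSets] at hS
      have := Finset.card_le_card hS.1
      rw [Nat.card_Ico] at this
      omega
    rw [key k, key (k + 1), avoid, once]
    exact ih e2 (k + 2)
  | arc c t ihc iht =>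
    rcases lt_or_ge k 2 with hk | hk
    · exact avoid_and_once_of_lt_two f _ o hk
    obtain ⟨k, rfl⟩ := Nat.exists_eq_add_of_le' hk
    have hm := fun p => Encodes.apply_mem (p := p) (t := arc c nil) ⟨h.1, h.2.1, h.2.2.1, trivial⟩
    obtain ⟨e1, e2, e3, e4⟩ := h
    simp only [size] at hm
    have hI : Finset.Ico o (o + size c + 2) =
        insert o (insert (o + size c + 1) (Finset.Ico (o + 1) (o + 1 + size c))) := by
      ext p
      simp only [Finset.mem_insert, Finset.mem_Ico]
      omega
    have key : ∀ l, l ≠ 0 → numDec f o (o + size (arc c t)) l = (decSets f (insert o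
        (insert (o + size c + 1) (Finset.Ico (o + 1) (o + 1 + size c)))) l).card +
        numDec f (o + size c + 2) (o + size c + 2 + size t) l := by
      intro l hl
      rw [size, show o + (size c + size t + 2) = o + size c + 2 + size t by omega,
        numDec_append (by omega) (fun p h1 h2 => by have := hm p h1 (by omega); omega) e4
          hl, ← hI]
      rfl
    obtain ⟨i1, i2⟩ := arc_indicators (k := k) e1 e2 (by omega) (by omega) e3
    rw [key _ (by omega), key _ (by omega), avoid, once, (ihc e3 k).1, (ihc e3 k).2,
      (iht e4 (k + 2)).1,
      (iht e4 (k + 2)).2, indZero_add, indOne_add card_decSets_succ_eq_zero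
      numDec_succ_eq_zero, i1, i2]
    exact ⟨rfl, rfl⟩
  | crossing A m B t ihA ihB iht =>
    rcases lt_or_ge k 2 with hk | hk
    · exact avoid_and_once_of_lt_two f _ o hk
    obtain ⟨k, rfl⟩ := Nat.exists_eq_add_of_le' hk
    have hc := h.isCrossing
    obtain ⟨e1, e2, e3, e4, e5, e6, e7, e8⟩ := h
    have hm := fun p => Encodes.apply_mem (p := p) (t := crossing A m B nil)
      ⟨e1, e2, e3, e4, e5, e6, e7, trivial⟩
    simp only [size] at hm
    have key : ∀ l, l ≠ 0 → numDec f o (o + size (crossing A m B t)) l =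
        (decSets f (Finset.Ico o (o + size A + m + size B + 4)) l).card +
        numDec f (o + size A + m + size B + 4) (o + size A + m + size B + 4 + size t) l := by
      intro l hl
      rw [size, show o + (size A + m + size B + size t + 4) =
        o + size A + m + size B + 4 + size t by omega,
        numDec_append (by omega) (fun p h1 h2 => by have := hm p h1 (by omega); omega) e8
          hl]
      rfl
    rw [key _ (by omega), key _ (by omega), avoid, once]
    split_ifs with hmk
    · have h3 : (decSets f (Finset.Ico o (o + size A + m + size B + 4)) (k + 2 + 1)).card = _ :=
        hc.card_decSets (Nat.lt_succ_of_lt hmk)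
      -- The recursion of `once` is the product rule for the parts on the two arcs and for `t`.
      obtain ⟨i1, i2⟩ := arc_indicators (k := k) e1 e3 (by omega) (by omega) e6
      obtain ⟨j1, j2⟩ := arc_indicators (k := k) e2 e4 (by omega) (by omega) e7
      rw [(ihA e6 k).1, (ihA e6 k).2, (ihB e7 k).1, (ihB e7 k).2, (iht e8 (k + 2)).1,
        (iht e8 (k + 2)).2, indZero_add, indOne_add card_decSets_succ_eq_zero
        numDec_succ_eq_zero, hc.card_decSets hmk, h3,
        indZero_add, indOne_add (x' := (decSets f (leftPart o (size A) m) (k + 2 + 1)).card)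
        (y' := (decSets f (rightPart o (size A) m (size B)) (k + 2 + 1)).card)
        card_decSets_succ_eq_zero card_decSets_succ_eq_zero]
      simp only [leftPart, rightPart]
      rw [i1, i2, j1, j2]
      exact ⟨rfl, rfl⟩
    · have := hc.one_lt_card_decSets (not_lt.1 hmk)
      unfold indZero indOne
      rw [if_neg (by omega), if_neg (by omega)]
      exact ⟨rfl, rfl⟩

end ArcTree

/-! ### From permutations to diagrams -/

namespace ArcTree

theorem finite_size_le (n : ℕ) : {t : ArcTree | size t ≤ n}.Finite := by
  induction n with
  | zero =>
    refine (Set.finite_singleton nil).subset fun t ht => ?_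
    cases t <;> simp only [Set.mem_ofPred_eq, size] at ht <;> first | rfl | omega
  | succ n ih =>
    have h1 := ih.image point
    have h2 := Set.Finite.image2 arc ih ih
    have h3 := Set.Finite.image2 (fun (p : ArcTree × ℕ) (q : ArcTree × ArcTree) =>
      crossing p.1 p.2 q.1 q.2) (ih.prod (Set.finite_Iic n)) (ih.prod ih)
    refine ((((Set.finite_singleton nil).union h1).union h2).union h3).subset fun t ht => ?_
    simp only [Set.mem_ofPred_eq] at ht
    cases t with
    | nil => exact Or.inl (Or.inl (Or.inl rfl))
    | point t =>
      simp only [size] at ht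
      exact Or.inl (Or.inl (Or.inr ⟨t, by simpa using ht, rfl⟩))
    | arc c t =>
      simp only [size] at ht
      exact Or.inl (Or.inr ⟨c, by simp; omega, t, by simp; omega, rfl⟩)
    | crossing A m B t =>
      simp only [size] at ht
      exact Or.inr ⟨(A, m), by simp; omega, (B, t), by simp; omega, rfl⟩

/-- The diagrams of involutions of `n` letters. -/
noncomputable def ofSize (n : ℕ) : Finset ArcTree :=
  ((finite_size_le n).subset fun t (ht : size t = n) => ht.le).toFinset

theorem mem_ofSize {n : ℕ} {t : ArcTree} : t ∈ ofSize n ↔ size t = n :=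
  Set.Finite.mem_toFinset _

end ArcTree

section Transport

open ArcTree

/-- The function on `ℕ` that agrees with `σ` on `[0, n)` and fixes all other numbers. -/
def permFun {n : ℕ} (σ : Equiv.Perm (Fin n)) (i : ℕ) : ℕ :=
  if h : i < n then σ ⟨i, h⟩ else i

theorem permFun_coe {n : ℕ} (σ : Equiv.Perm (Fin n)) (i : Fin n) : permFun σ i = σ i := by
  simp [permFun]

theorem permFun_lt {n : ℕ} (σ : Equiv.Perm (Fin n)) {i : ℕ} (h : i < n) : permFun σ i < n := by
  simp [permFun, h]

theorem occurrences_perm3412 {n : ℕ} (σ : Equiv.Perm (Fin n)) :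
    RestrictedInvolutions.occurrences σ RestrictedInvolutions.perm3412 =
      (quads (permFun σ) (Finset.Ico 0 (0 + n))).card := by
  have key : ∀ f : Fin 4 → Fin n, ((∀ a b, a < b → f a < f b) ∧ ∀ a b, σ (f a) < σ (f b) ↔
      RestrictedInvolutions.perm3412 a < RestrictedInvolutions.perm3412 b) ↔
      ((f 0 < f 1 ∧ f 1 < f 2 ∧ f 2 < f 3) ∧ σ (f 2) < σ (f 3) ∧ σ (f 3) < σ (f 0) ∧
        σ (f 0) < σ (f 1)) := by
    intro f
    constructor
    · rintro ⟨h1, h2⟩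
      exact ⟨⟨h1 0 1 (by decide), h1 1 2 (by decide), h1 2 3 (by decide)⟩,
        (h2 2 3).2 (by decide), (h2 3 0).2 (by decide), (h2 0 1).2 (by decide)⟩
    · rintro ⟨⟨h1, h2, h3⟩, h4, h5, h6⟩
      constructor
      · intro a b hab
        fin_cases a <;> fin_cases b <;> simp at hab ⊢ <;> order
      · intro a b
        fin_cases a <;> fin_cases b <;> simp [RestrictedInvolutions.perm3412] <;> order
  rw [RestrictedInvolutions.occurrences, Fintype.card_subtype]
  refine Finset.card_bij (fun f _ => ((f 0 : ℕ), (f 1 : ℕ), (f 2 : ℕ), (f 3 : ℕ))) ?_ ?_ ?_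
  · intro f hf
    rw [Finset.mem_filter, key] at hf
    simp only [mem_quads, Finset.mem_Ico, permFun_coe]
    have := (f 0).2
    have := (f 1).2
    have := (f 2).2
    have := (f 3).2
    refine ⟨by omega, hf.2.1, hf.2.2⟩
  · intro f hf g hg h
    simp only [Prod.mk.injEq] at h
    funext a
    fin_cases a
    · exact Fin.ext h.1
    · exact Fin.ext h.2.1
    · exact Fin.ext h.2.2.1
    · exact Fin.ext h.2.2.2
  · rintro ⟨p, q, r, u⟩ h
    simp only [mem_quads, Finset.mem_Ico] at h
    obtain ⟨⟨hp, hq, hr, hu⟩, h1, h2⟩ := h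
    refine ⟨![⟨p, by omega⟩, ⟨q, by omega⟩, ⟨r, by omega⟩, ⟨u, by omega⟩], ?_, rfl⟩
    rw [Finset.mem_filter, key]
    refine ⟨Finset.mem_univ _, h1, ?_⟩
    simp only [permFun] at h2
    rw [dif_pos (by omega), dif_pos (by omega), dif_pos (by omega), dif_pos (by omega)] at h2
    exact h2

theorem occurrences_decreasing {n : ℕ} (σ : Equiv.Perm (Fin n)) (k : ℕ) :
    RestrictedInvolutions.occurrences σ (RestrictedInvolutions.decreasing k) =
      numDec (permFun σ) 0 (0 + n) k := by
  classical
  rw [RestrictedInvolutions.occurrences, Fintype.card_subtype, numDec]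
  have key : ∀ f : Fin k → Fin n, (∀ a b, a < b → f a < f b) →
      StrictMono fun a => (f a : ℕ) := fun f hf a b hab => hf a b hab
  refine Finset.card_bij (fun f _ => Finset.univ.image fun a => (f a : ℕ)) ?_ ?_ ?_
  · intro f hf
    rw [Finset.mem_filter] at hf
    rw [mem_decSets]
    refine ⟨?_, ?_, ?_⟩
    · intro p hp
      simp only [Finset.mem_image, Finset.mem_univ, true_and] at hp
      obtain ⟨a, rfl⟩ := hp
      have := (f a).2
      simp
    · rw [Finset.card_image_of_injective _ (key f hf.2.1).injective, Finset.card_univ,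
        Fintype.card_fin]
    · intro p hp q hq hpq
      simp only [Finset.mem_image, Finset.mem_univ, true_and] at hp hq
      obtain ⟨a, rfl⟩ := hp
      obtain ⟨b, rfl⟩ := hq
      rw [permFun_coe, permFun_coe]
      have hab : a < b := (key f hf.2.1).lt_iff_lt.1 hpq
      exact (hf.2.2 b a).2 (by simpa [RestrictedInvolutions.decreasing] using hab)
  · intro f hf g hg h
    rw [Finset.mem_filter] at hf hg
    have := (StrictMono.range_inj (key f hf.2.1) (key g hg.2.1)).1 (by
      simpa using congrArg (fun S : Finset ℕ => (S : Set ℕ)) h)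
    funext a
    exact Fin.ext (congrFun this a)
  · intro S hS
    rw [mem_decSets] at hS
    obtain ⟨h1, h2, h3⟩ := hS
    have hlt : ∀ a, S.orderEmbOfFin h2 a < n := fun a => by
      have := h1 (S.orderEmbOfFin_mem h2 a)
      simpa using this
    refine ⟨fun a => ⟨S.orderEmbOfFin h2 a, hlt a⟩, ?_, ?_⟩
    · rw [Finset.mem_filter]
      have hlt' : ∀ a b, a < b →
          σ ⟨S.orderEmbOfFin h2 b, hlt b⟩ < σ ⟨S.orderEmbOfFin h2 a, hlt a⟩ := by
        intro a b hab
        have := h3 _ (S.orderEmbOfFin_mem h2 a) _ (S.orderEmbOfFin_mem h2 b)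
          ((S.orderEmbOfFin h2).lt_iff_lt.2 hab)
        simpa [permFun, hlt a, hlt b] using this
      refine ⟨Finset.mem_univ _, fun a b hab => (S.orderEmbOfFin h2).lt_iff_lt.2 hab,
        fun a b => ?_⟩
      have hrev : RestrictedInvolutions.decreasing k a < RestrictedInvolutions.decreasing k b ↔
        b < a := by simp [RestrictedInvolutions.decreasing]
      rw [hrev]
      refine ⟨fun h => ?_, hlt' b a⟩
      by_contra hc
      rcases (not_lt.1 hc).eq_or_lt with rfl | hc
      · exact lt_irrefl _ h
      · exact lt_asymm h (hlt' a b hc)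
    · apply Finset.coe_injective
      simp

/-- Involutions with one occurrence of `3412` and one of `k ⋯ 2 1` correspond to their diagrams. -/
theorem card_involutionsOnce (n : ℕ) {k : ℕ} (hk : 1 ≤ k) :
    ((RestrictedInvolutions.involutionsOnce n (RestrictedInvolutions.decreasing k)).card : ℚ) =
      ∑ t ∈ ofSize n, once t k * indOne (crossings t) 0 := by
  classical
  have key : (RestrictedInvolutions.involutionsOnce n (RestrictedInvolutions.decreasing k)).card =
      ((ofSize n).filter fun t => once t k = 1 ∧ crossings t = 1).card := by
    have enc : ∀ σ ∈ RestrictedInvolutions.involutionsOnce n (RestrictedInvolutions.decreasing k),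
        ∃ t : ArcTree, size t = n ∧ Encodes (permFun σ) t 0 := by
      intro σ hσ
      simp only [RestrictedInvolutions.involutionsOnce, Finset.mem_filter, Finset.mem_univ,
        true_and] at hσ
      refine exists_encodes_of_card_quads_le_one n 0 (fun p _ hp => ⟨Nat.zero_le _, ?_⟩)
        (fun p _ hp => ?_) ?_
      · rw [zero_add] at hp ⊢; exact permFun_lt σ hp
      · rw [zero_add] at hp
        have := congrArg Fin.val (hσ.1 ⟨p, hp⟩)
        rwa [← permFun_coe, ← permFun_coe] at this
      · rw [← occurrences_perm3412, hσ.2.1]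
    have iff_enc : ∀ (σ : Equiv.Perm (Fin n)) (t : ArcTree), size t = n →
        Encodes (permFun σ) t 0 →
        ((RestrictedInvolutions.occurrences σ RestrictedInvolutions.perm3412 = 1 ∧
          RestrictedInvolutions.occurrences σ (RestrictedInvolutions.decreasing k) = 1) ↔
          (once t k = 1 ∧ crossings t = 1)) := by
      intro σ t ht he
      have h1 := he.card_quads
      have h2 := (he.avoid_and_once k).2
      rw [ht] at h1 h2
      rw [occurrences_perm3412, occurrences_decreasing, h1, h2, and_comm]
      refine and_congr_left fun _ => ?_
      unfold indOne
      constructor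
      · intro h
        rw [if_pos ⟨h, card_decSets_succ_eq_zero_of_eq_one hk h⟩]
      · intro h
        by_contra hc
        rw [if_neg fun h => hc h.1] at h
        exact zero_ne_one h
    refine Finset.card_bij (fun σ hσ => (enc σ hσ).choose) ?_ ?_ ?_
    · intro σ hσ
      obtain ⟨h1, h2⟩ := (enc σ hσ).choose_spec
      rw [Finset.mem_filter, mem_ofSize]
      refine ⟨h1, (iff_enc σ _ h1 h2).1 ?_⟩
      simp only [RestrictedInvolutions.involutionsOnce, Finset.mem_filter] at hσ
      exact hσ.2.2
    · intro σ hσ τ hτ h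
      obtain ⟨h1, h2⟩ := (enc σ hσ).choose_spec
      obtain ⟨h3, h4⟩ := (enc τ hτ).choose_spec
      rw [← h] at h4
      ext i
      rw [← permFun_coe, ← permFun_coe]
      exact h2.eqOn h4 (Nat.zero_le _) (by rw [h1, zero_add]; exact i.2)
    · intro t ht
      rw [Finset.mem_filter, mem_ofSize] at ht
      obtain ⟨f, hf⟩ := exists_encodes t 0
      have hf1 : ∀ i : Fin n, f i < n := fun i => by
        have := hf.apply_mem (p := i) (Nat.zero_le _) (by rw [ht.1, zero_add]; exact i.2)
        rw [ht.1, zero_add] at this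
        exact this.2
      have hf2 : ∀ i : Fin n, f (f i) = i := fun i =>
        hf.apply_apply (Nat.zero_le _) (by rw [ht.1, zero_add]; exact i.2)
      let σ : Equiv.Perm (Fin n) :=
        ⟨fun i => ⟨f i, hf1 i⟩, fun i => ⟨f i, hf1 i⟩, fun i => Fin.ext (hf2 i),
          fun i => Fin.ext (hf2 i)⟩
      have he : Encodes (permFun σ) t 0 := hf.congr fun p _ hp => by
        rw [ht.1, zero_add] at hp
        rw [permFun, dif_pos hp]
        rfl
      have hσ : σ ∈ RestrictedInvolutions.involutionsOnce n
          (RestrictedInvolutions.decreasing k) := by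
        simp only [RestrictedInvolutions.involutionsOnce, Finset.mem_filter, Finset.mem_univ,
          true_and]
        exact ⟨fun i => Fin.ext (hf2 i), (iff_enc σ t ht.1 he).2 ht.2⟩
      obtain ⟨h1, h2⟩ := (enc σ hσ).choose_spec
      exact ⟨σ, hσ, h2.unique he (h1.trans ht.1.symm)⟩
  rw [key, Finset.card_filter, Nat.cast_sum]
  refine Finset.sum_congr rfl fun t ht => ?_
  obtain ⟨f, hf⟩ := exists_encodes t 0
  rw [(hf.avoid_and_once k).2]
  unfold indOne
  split_ifs <;> simp_all

end Transport

/-! ### Generating functions -/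

namespace ArcTree

open PowerSeries
open Finset.HasAntidiagonal (antidiagonal)

/-- The generating function of the diagrams, by size, with weights `w`. -/
noncomputable def genFun (w : ArcTree → ℚ) : PowerSeries ℚ := mk fun n => ∑ t ∈ ofSize n, w t

/-- The generating function of the pairs of diagrams, by total size, with weights `w`. -/
noncomputable def genFunPair (w : ArcTree → ArcTree → ℚ) : PowerSeries ℚ :=
  mk fun n => ∑ p ∈ antidiagonal n, ∑ c ∈ ofSize p.1, ∑ t ∈ ofSize p.2, w c t

/-- The generating function, with weights `w`, of the data `A`, `m`, `B`, `t` of a node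
`crossing A m B t`. -/
noncomputable def genFunCrossing (w : ArcTree → ℕ → ArcTree → ArcTree → ℚ) : PowerSeries ℚ :=
  mk fun n => ∑ p ∈ antidiagonal n, ∑ q ∈ antidiagonal p.1,
    ∑ r ∈ antidiagonal p.2, ∑ A ∈ ofSize q.1, ∑ B ∈ ofSize r.1, ∑ t ∈ ofSize r.2,
      w A q.2 B t

theorem genFunPair_add (w w' : ArcTree → ArcTree → ℚ) :
    genFunPair (fun c t => w c t + w' c t) = genFunPair w + genFunPair w' := by
  ext n
  simp only [genFunPair, coeff_mk, map_add, Finset.sum_add_distrib]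

theorem genFunCrossing_add (w w' : ArcTree → ℕ → ArcTree → ArcTree → ℚ) :
    genFunCrossing (fun A m B t => w A m B t + w' A m B t) =
      genFunCrossing w + genFunCrossing w' := by
  ext n
  simp only [genFunCrossing, coeff_mk, map_add, Finset.sum_add_distrib]

/-- A weight that is a product gives a product of generating functions. -/
theorem genFunPair_mul (u v : ArcTree → ℚ) :
    genFunPair (fun c t => u c * v t) = genFun u * genFun v := by
  ext n
  simp only [genFunPair, genFun, coeff_mk, coeff_mul, Finset.sum_mul_sum]

theorem genFunCrossing_mul (u : ArcTree → ℚ) (a : ℕ → ℚ) (v w : ArcTree → ℚ) :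
    genFunCrossing (fun A m B t => a m * (u A * v B * w t)) =
      mk a * (genFun u * genFun v * genFun w) := by
  have : mk a * (genFun u * genFun v * genFun w) =
      (genFun u * mk a) * (genFun v * genFun w) := by ring
  rw [this]
  ext n
  simp only [genFunCrossing, genFun, coeff_mk, coeff_mul]
  refine Finset.sum_congr rfl fun p _ => ?_
  rw [Finset.sum_mul_sum]
  refine Finset.sum_congr rfl fun q _ => Finset.sum_congr rfl fun r _ => ?_
  rw [Finset.sum_mul_sum, Finset.sum_mul, Finset.sum_mul]
  refine Finset.sum_congr rfl fun A _ => ?_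
  rw [Finset.mul_sum]
  refine Finset.sum_congr rfl fun B _ => ?_
  rw [Finset.mul_sum]
  exact Finset.sum_congr rfl fun t _ => by ring

/-! The contribution of each kind of first node to a sum over the diagrams of given size. -/

theorem sum_ofSize_point (w : ArcTree → ℚ) (n : ℕ) :
    ∑ t ∈ ofSize (n + 1), (match t with | point t => w t | _ => 0) = ∑ t ∈ ofSize n, w t := by
  symm
  refine Finset.sum_of_injOn point (fun _ _ _ _ h => by simpa using h) (fun t ht => ?_) ?_
    fun _ _ => rfl
  · simp only [Finset.mem_coe, mem_ofSize] at ht ⊢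
    simp only [size, ht]
  · intro t ht h
    cases t with
    | point t =>
      simp only [mem_ofSize, size, Nat.add_right_cancel_iff] at ht
      exact absurd ⟨t, by simpa [mem_ofSize] using ht, rfl⟩ h
    | _ => rfl

theorem sum_ofSize_arc (w : ArcTree → ArcTree → ℚ) (n : ℕ) :
    ∑ t ∈ ofSize (n + 2), (match t with | arc c t => w c t | _ => 0) =
      ∑ p ∈ antidiagonal n, ∑ c ∈ ofSize p.1, ∑ t ∈ ofSize p.2, w c t := by
  symm
  simp only [← Finset.sum_product']
  rw [Finset.sum_sigma']
  refine Finset.sum_of_injOn (fun x => arc x.2.1 x.2.2) ?_ ?_ ?_ fun _ _ => rfl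
  · rintro ⟨⟨i, j⟩, c, t⟩ h ⟨⟨i', j'⟩, c', t'⟩ h' e
    simp only [Finset.coe_sigma, Set.mem_sigma_iff, Finset.mem_coe,
      Finset.HasAntidiagonal.mem_antidiagonal, Finset.mem_product, mem_ofSize] at h h'
    simp only [arc.injEq] at e
    obtain ⟨rfl, rfl⟩ := e
    obtain ⟨-, rfl, rfl⟩ := h
    obtain ⟨-, rfl, rfl⟩ := h'
    rfl
  · rintro ⟨⟨i, j⟩, c, t⟩ h
    simp only [Finset.coe_sigma, Set.mem_sigma_iff, Finset.mem_coe,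
      Finset.HasAntidiagonal.mem_antidiagonal, Finset.mem_product, mem_ofSize] at h ⊢
    simp only [size]
    omega
  · intro t ht h
    cases t with
    | arc c t =>
      simp only [mem_ofSize, size] at ht
      refine absurd ⟨⟨(size c, size t), c, t⟩, ?_, rfl⟩ h
      simp only [Finset.coe_sigma, Set.mem_sigma_iff, Finset.mem_coe,
        Finset.HasAntidiagonal.mem_antidiagonal, Finset.mem_product, mem_ofSize, and_true]
      omega
    | _ => rfl

theorem sum_ofSize_crossing (w : ArcTree → ℕ → ArcTree → ArcTree → ℚ) (n : ℕ) :
    ∑ t ∈ ofSize (n + 4), (match t with | crossing A m B t => w A m B t | _ => 0) =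
      ∑ p ∈ antidiagonal n, ∑ q ∈ antidiagonal p.1,
        ∑ r ∈ antidiagonal p.2, ∑ A ∈ ofSize q.1, ∑ B ∈ ofSize r.1, ∑ t ∈ ofSize r.2,
          w A q.2 B t := by
  symm
  simp only [← Finset.sum_product']
  simp only [Finset.sum_sigma']
  refine Finset.sum_of_injOn
    (fun x => crossing x.2.2.1 x.2.1.1.2 x.2.2.2.1 x.2.2.2.2) ?_ ?_ ?_ fun _ _ => rfl
  · rintro ⟨⟨i, j⟩, ⟨⟨a, m⟩, b, l⟩, A, B, t⟩ h ⟨⟨i', j'⟩, ⟨⟨a', m'⟩, b', l'⟩, A', B', t'⟩ h' e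
    simp only [Finset.coe_sigma, Set.mem_sigma_iff, Finset.mem_coe,
      Finset.HasAntidiagonal.mem_antidiagonal, Finset.mem_product, mem_ofSize] at h h'
    simp only [crossing.injEq] at e
    obtain ⟨rfl, rfl, rfl, rfl⟩ := e
    obtain ⟨-, ⟨rfl, rfl⟩, rfl, rfl, rfl⟩ := h
    obtain ⟨-, ⟨rfl, rfl⟩, rfl, rfl, rfl⟩ := h'
    rfl
  · rintro ⟨⟨i, j⟩, ⟨⟨a, m⟩, b, l⟩, A, B, t⟩ h
    simp only [Finset.coe_sigma, Set.mem_sigma_iff, Finset.mem_coe,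
      Finset.HasAntidiagonal.mem_antidiagonal, Finset.mem_product, mem_ofSize] at h ⊢
    simp only [size]
    omega
  · intro t ht h
    cases t with
    | crossing A m B t =>
      simp only [mem_ofSize, size] at ht
      refine absurd ⟨⟨(size A + m, size B + size t), ((size A, m), (size B, size t)), A, B, t⟩,
        ?_, rfl⟩ h
      simp only [Finset.coe_sigma, Set.mem_sigma_iff, Finset.mem_coe,
        Finset.HasAntidiagonal.mem_antidiagonal, Finset.mem_product, mem_ofSize, and_true]
      omega
    | _ => rfl

/-- A diagram is empty, or begins with a fixed point, an arc, or a crossing. -/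
theorem genFun_eq (w : ArcTree → ℚ) : genFun w = C (w nil) + X * genFun (fun t => w (point t)) +
    X ^ 2 * genFunPair (fun c t => w (arc c t)) +
    X ^ 4 * genFunCrossing (fun A m B t => w (crossing A m B t)) := by
  ext n
  have key : ∀ t, w t = (match t with | nil => w nil | _ => 0) +
      (match t with | point t => w (point t) | _ => 0) +
      (match t with | arc c t => w (arc c t) | _ => 0) +
      (match t with | crossing A m B t => w (crossing A m B t) | _ => 0) := by
    intro t; cases t <;> simp
  simp only [map_add, coeff_X_pow_mul']
  rw [show coeff n (X * genFun fun t => w (point t)) = _ from by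
    rw [← pow_one X, coeff_X_pow_mul']]
  rw [genFun, coeff_mk, Finset.sum_congr rfl fun t _ => key t]
  simp only [Finset.sum_add_distrib]
  congr 1
  · congr 1
    · congr 1
      · rw [coeff_C]
        split_ifs with h
        · rw [Finset.sum_eq_single nil]
          · intro t _ ht
            cases t <;> first | rfl | exact absurd rfl ht
          · intro ht
            exact absurd (mem_ofSize.2 (by rw [h, size])) ht
        · refine Finset.sum_eq_zero fun t ht => ?_
          cases t with
          | nil => exact absurd (mem_ofSize.1 ht).symm h
          | _ => rfl
      · split_ifs with h
        · obtain ⟨n, rfl⟩ := Nat.exists_eq_add_of_le' h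
          rw [sum_ofSize_point fun t => w (point t)]
          simp [genFun]
        · refine Finset.sum_eq_zero fun t ht => ?_
          cases t with
          | point t => have := mem_ofSize.1 ht; simp only [size] at this; omega
          | _ => rfl
    · split_ifs with h
      · obtain ⟨n, rfl⟩ := Nat.exists_eq_add_of_le' h
        rw [sum_ofSize_arc fun c t => w (arc c t)]
        simp [genFunPair]
      · refine Finset.sum_eq_zero fun t ht => ?_
        cases t with
        | arc c t => have := mem_ofSize.1 ht; simp only [size] at this; omega
        | _ => rfl
  · split_ifs with h
    · obtain ⟨n, rfl⟩ := Nat.exists_eq_add_of_le' h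
      rw [sum_ofSize_crossing fun A m B t => w (crossing A m B t)]
      simp [genFunCrossing]
    · refine Finset.sum_eq_zero fun t ht => ?_
      cases t with
      | crossing A m B t => have := mem_ofSize.1 ht; simp only [size] at this; omega
      | _ => rfl

/-- Diagrams without crossings and without decreasing subsequence of length `k`. -/
noncomputable def genF (k : ℕ) : PowerSeries ℚ :=
  genFun fun t => avoid t k * indZero (crossings t)

/-- Diagrams without crossings and with one decreasing subsequence of length `k`. -/
noncomputable def genG (k : ℕ) : PowerSeries ℚ :=
  genFun fun t => once t k * indZero (crossings t)

/-- Diagrams with one crossing and without decreasing subsequence of length `k`. -/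
noncomputable def genP (k : ℕ) : PowerSeries ℚ :=
  genFun fun t => avoid t k * indOne (crossings t) 0

/-- Diagrams with one crossing and one decreasing subsequence of length `k`. -/
noncomputable def genQ (k : ℕ) : PowerSeries ℚ :=
  genFun fun t => once t k * indOne (crossings t) 0

/-- `1 + x + ⋯ + x ^ (k - 1)`. -/
noncomputable def geom (k : ℕ) : PowerSeries ℚ := mk fun m => if m < k then 1 else 0

theorem indOne_add_zero (x y : ℕ) :
    indOne (x + y) 0 = indOne x 0 * indZero y + indZero x * indOne y 0 :=
  indOne_add (x' := 0) (y' := 0) (fun _ => rfl) fun _ => rfl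

theorem indZero_succ (x : ℕ) : indZero (x + 1) = 0 := if_neg (by omega)

theorem indOne_succ (x : ℕ) : indOne (x + 1) 0 = indZero x := by
  simp [indOne, indZero]

theorem genFun_zero : genFun (fun _ => 0) = 0 := by
  ext n; simp [genFun]

theorem genFunCrossing_zero : genFunCrossing (fun _ _ _ _ => 0) = 0 := by
  ext n; simp [genFunCrossing]

/-! In each recurrence the terms on the right belong to the first nodes `nil`, `point`, `arc` and
`crossing`; a property of the diagram is distributed in all ways over its parts. -/

theorem genF_add_two (k : ℕ) :
    genF (k + 2) = 1 + X * genF (k + 2) + X ^ 2 * (genF k * genF (k + 2)) := by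
  have h := genFun_eq fun t => avoid t (k + 2) * indZero (crossings t)
  have h1 : (fun c t => avoid (arc c t) (k + 2) * indZero (crossings (arc c t))) = fun c t =>
      (avoid c k * indZero (crossings c)) * (avoid t (k + 2) * indZero (crossings t)) := by
    funext c t
    rw [avoid, crossings, indZero_add]
    ring
  have h2 : (fun A m B t => avoid (crossing A m B t) (k + 2) *
      indZero (crossings (crossing A m B t))) = fun _ _ _ _ => 0 := by
    funext A m B t
    rw [crossings, indZero_succ, mul_zero]
  rw [h1, h2, genFunPair_mul, genFunCrossing_zero, mul_zero, add_zero] at h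
  have h0 : avoid nil (k + 2) * indZero (crossings nil) = 1 := by
    simp [avoid, crossings, indZero]
  simp only [h0, map_one] at h
  exact h

theorem genG_add_two (k : ℕ) : genG (k + 2) = X * genG (k + 2) +
    X ^ 2 * (genG k * genF (k + 2) + genF k * genG (k + 2)) := by
  have h := genFun_eq fun t => once t (k + 2) * indZero (crossings t)
  have h1 : (fun c t => once (arc c t) (k + 2) * indZero (crossings (arc c t))) = fun c t =>
      (once c k * indZero (crossings c)) * (avoid t (k + 2) * indZero (crossings t)) +
      (avoid c k * indZero (crossings c)) * (once t (k + 2) * indZero (crossings t)) := by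
    funext c t
    rw [once, crossings, indZero_add]
    ring
  have h2 : (fun A m B t => once (crossing A m B t) (k + 2) *
      indZero (crossings (crossing A m B t))) = fun _ _ _ _ => 0 := by
    funext A m B t
    rw [crossings, indZero_succ, mul_zero]
  rw [h1, h2, genFunPair_add, genFunPair_mul, genFunPair_mul, genFunCrossing_zero, mul_zero,
    add_zero] at h
  have h0 : once nil (k + 2) * indZero (crossings nil) = 0 := by
    simp [once, crossings, indZero]
  simp only [h0, map_zero, zero_add] at h
  exact h

theorem genP_add_two (k : ℕ) : genP (k + 2) = X * genP (k + 2) +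
    X ^ 2 * (genP k * genF (k + 2) + genF k * genP (k + 2)) +
    X ^ 4 * (geom k * (genF k * genF k * genF (k + 2))) := by
  have h := genFun_eq fun t => avoid t (k + 2) * indOne (crossings t) 0
  have h1 : (fun c t => avoid (arc c t) (k + 2) * indOne (crossings (arc c t)) 0) = fun c t =>
      (avoid c k * indOne (crossings c) 0) * (avoid t (k + 2) * indZero (crossings t)) +
      (avoid c k * indZero (crossings c)) * (avoid t (k + 2) * indOne (crossings t) 0) := by
    funext c t
    rw [avoid, crossings, indOne_add_zero]
    ring
  have h2 : (fun A m B t => avoid (crossing A m B t) (k + 2) *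
      indOne (crossings (crossing A m B t)) 0) = fun A m B t => (if m < k then 1 else 0) *
        ((avoid A k * indZero (crossings A)) * (avoid B k * indZero (crossings B)) *
          (avoid t (k + 2) * indZero (crossings t))) := by
    funext A m B t
    rw [crossings, indOne_succ, indZero_add, indZero_add, avoid]
    split_ifs <;> ring
  rw [h1, h2, genFunPair_add, genFunPair_mul, genFunPair_mul, genFunCrossing_mul] at h
  have h0 : avoid nil (k + 2) * indOne (crossings nil) 0 = 0 := by
    simp [avoid, crossings, indOne]
  simp only [h0, map_zero, zero_add] at h
  exact h

theorem genQ_add_two (k : ℕ) : genQ (k + 2) = X * genQ (k + 2) +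
    X ^ 2 * (genQ k * genF (k + 2) + genP k * genG (k + 2) + genG k * genP (k + 2) +
      genF k * genQ (k + 2)) +
    X ^ 4 * (geom k * (genG k * genF k * genF (k + 2)) +
      geom k * (genF k * genG k * genF (k + 2)) + geom k * (genF k * genF k * genG (k + 2))) := by
  have h := genFun_eq fun t => once t (k + 2) * indOne (crossings t) 0
  have h1 : (fun c t => once (arc c t) (k + 2) * indOne (crossings (arc c t)) 0) = fun c t =>
      (once c k * indOne (crossings c) 0) * (avoid t (k + 2) * indZero (crossings t)) +
      (avoid c k * indOne (crossings c) 0) * (once t (k + 2) * indZero (crossings t)) +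
      (once c k * indZero (crossings c)) * (avoid t (k + 2) * indOne (crossings t) 0) +
      (avoid c k * indZero (crossings c)) * (once t (k + 2) * indOne (crossings t) 0) := by
    funext c t
    rw [once, crossings, indOne_add_zero]
    ring
  have h2 : (fun A m B t => once (crossing A m B t) (k + 2) *
      indOne (crossings (crossing A m B t)) 0) = fun A m B t =>
        (if m < k then 1 else 0) *
          ((once A k * indZero (crossings A)) * (avoid B k * indZero (crossings B)) *
            (avoid t (k + 2) * indZero (crossings t))) +
        (if m < k then 1 else 0) *
          ((avoid A k * indZero (crossings A)) * (once B k * indZero (crossings B)) *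
            (avoid t (k + 2) * indZero (crossings t))) +
        (if m < k then 1 else 0) *
          ((avoid A k * indZero (crossings A)) * (avoid B k * indZero (crossings B)) *
            (once t (k + 2) * indZero (crossings t))) := by
    funext A m B t
    rw [crossings, indOne_succ, indZero_add, indZero_add, once]
    split_ifs <;> ring
  rw [h1, h2, genFunPair_add, genFunPair_add, genFunPair_add, genFunPair_mul, genFunPair_mul,
    genFunPair_mul, genFunPair_mul, genFunCrossing_add, genFunCrossing_add, genFunCrossing_mul,
    genFunCrossing_mul, genFunCrossing_mul] at h
  have h0 : once nil (k + 2) * indOne (crossings nil) 0 = 0 := by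
    simp [once, crossings, indOne]
  simp only [h0, map_zero, zero_add] at h
  exact h

/-- A generating function with weights concentrated on one diagram. -/
theorem genFun_eq_single {w : ArcTree → ℚ} (t₀ : ArcTree) (h : ∀ t, t ≠ t₀ → w t = 0) :
    genFun w = C (w t₀) * X ^ size t₀ := by
  ext n
  rw [genFun, coeff_mk, coeff_C_mul, coeff_X_pow]
  split_ifs with hn
  · rw [mul_one, Finset.sum_eq_single_of_mem t₀ (mem_ofSize.2 hn.symm) fun t _ ht => h t ht]
  · rw [mul_zero]
    refine Finset.sum_eq_zero fun t ht => h t ?_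
    rintro rfl
    exact hn (mem_ofSize.1 ht).symm

theorem genF_zero : genF 0 = 0 := by simp [genF, avoid, genFun_zero]

theorem genP_zero : genP 0 = 0 := by simp [genP, avoid, genFun_zero]

theorem genG_zero : genG 0 = 1 := by
  rw [genG, genFun_eq_single nil]
  · simp [once, crossings, indZero, size]
  · intro t ht
    cases t <;> simp_all [once]

theorem genQ_zero : genQ 0 = 0 := by
  rw [genQ, genFun_eq_single nil]
  · simp [once, crossings, indOne, size]
  · intro t ht
    cases t <;> simp_all [once]

theorem genF_one : genF 1 = 1 := by
  rw [genF, genFun_eq_single nil]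
  · simp [avoid, crossings, indZero, size]
  · intro t ht
    cases t <;> simp_all [avoid]

theorem genP_one : genP 1 = 0 := by
  rw [genP, genFun_eq_single nil]
  · simp [avoid, crossings, indOne, size]
  · intro t ht
    cases t <;> simp_all [avoid]

theorem once_one_of_ne {t : ArcTree} (ht : t ≠ point nil) : once t 1 = 0 := by
  rcases t with _ | (_ | _ | _ | _) | _ | _ <;> simp_all [once]

theorem genG_one : genG 1 = X := by
  rw [genG, genFun_eq_single (point nil)]
  · simp [once, crossings, indZero, size]
  · intro t ht
    rw [once_one_of_ne ht, zero_mul]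

theorem genQ_one : genQ 1 = 0 := by
  rw [genQ, genFun_eq_single (point nil)]
  · simp [once, crossings, indOne, size]
  · intro t ht
    rw [once_one_of_ne ht, zero_mul]

theorem one_sub_X_mul_geom (k : ℕ) : (1 - X) * geom k = 1 - X ^ k := by
  have : geom k = ∑ i ∈ Finset.range k, X ^ i := by
    ext m
    simp [geom, coeff_X_pow]
  rw [this, mul_comm, geom_sum_mul_neg]

theorem Qplus_eq_genQ {k : ℕ} (hk : 1 ≤ k) :
    RestrictedInvolutions.Qplus (RestrictedInvolutions.decreasing k) = genQ k := by
  ext n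
  rw [RestrictedInvolutions.Qplus, coeff_mk, card_involutionsOnce n hk, genQ, genFun, coeff_mk]

end ArcTree

/-! ### Chebyshev polynomials and the closed forms -/

/-- The solution of the recurrences for the four generating functions, in terms of a solution `v` of
the Chebyshev recurrence: `F i = v i / (x v (i + 1))`, while `G i v (i + 1) ^ 2` is constant, and
`P i v (i + 1) ^ 2` and `Q i v (i + 1) ^ 2` are sums. -/
theorem closed_form_of_recurrences {K : Type*} [Field K] {x γ : K} {v F G P Q M : ℕ → K}
    (hx : x ≠ 0) (hv1 : v 1 ≠ 0)
    (hv : ∀ i, x * v (i + 2) = (1 - x) * v (i + 1) - x * v i)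
    (hF0 : F 0 * (x * v 1) = v 0) (hG0 : G 0 * v 1 ^ 2 = γ) (hP0 : P 0 = 0) (hQ0 : Q 0 = 0)
    (hF : ∀ i, F (i + 1) = 1 + x * F (i + 1) + x ^ 2 * (F i * F (i + 1)))
    (hG : ∀ i, G (i + 1) = x * G (i + 1) + x ^ 2 * (G i * F (i + 1) + F i * G (i + 1)))
    (hP : ∀ i, P (i + 1) = x * P (i + 1) + x ^ 2 * (P i * F (i + 1) + F i * P (i + 1)) +
      x ^ 4 * (M i * (F i * F i * F (i + 1))))
    (hQ : ∀ i, Q (i + 1) = x * Q (i + 1) +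
      x ^ 2 * (Q i * F (i + 1) + P i * G (i + 1) + G i * P (i + 1) + F i * Q (i + 1)) +
      x ^ 4 * (M i * (G i * F i * F (i + 1)) + M i * (F i * G i * F (i + 1)) +
        M i * (F i * F i * G (i + 1)))) (k : ℕ) :
    v (k + 1) ≠ 0 ∧ Q k * v (k + 1) ^ 2 = 2 * x * γ * ∑ l ∈ Finset.range k,
      (M l * v l * v (l + 2) + ∑ j ∈ Finset.range (l + 1), M j * v j ^ 2) /
        (v (l + 1) * v (l + 2)) := by
  -- `v (i + 1) = F (i + 1) (x v (i + 2))`, so that `v` cannot vanish after `v 1`.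
  have hFv : ∀ i, v (i + 1) ≠ 0 ∧ F i * (x * v (i + 1)) = v i := by
    intro i
    induction i with
    | zero => exact ⟨hv1, hF0⟩
    | succ i ih =>
      have h : F (i + 1) * (x * v (i + 2)) = v (i + 1) := by
        rw [hv]
        linear_combination v (i + 1) * hF i + x * F (i + 1) * ih.2
      refine ⟨fun h0 => ih.1 ?_, h⟩
      rw [← h, h0, mul_zero, mul_zero]
  have hne := fun i => (hFv i).1
  have hF' : ∀ i, F i = v i / (x * v (i + 1)) := fun i => by
    rw [eq_div_iff (mul_ne_zero hx (hne i)), (hFv i).2]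
  have hG' : ∀ i, G i * v (i + 1) ^ 2 = γ := by
    intro i
    induction i with
    | zero => exact hG0
    | succ i ih =>
      -- The recurrence of `F` says that `1 - x - x ^ 2 F i` is the inverse of `F (i + 1)`.
      have h : G (i + 1) = x ^ 2 * G i * F (i + 1) ^ 2 := by
        linear_combination F (i + 1) * hG i - G (i + 1) * hF i
      rw [h, ← ih, hF' (i + 1)]
      have := hne (i + 1)
      field_simp
  have hP' : ∀ i, P i * v (i + 1) ^ 2 = ∑ j ∈ Finset.range i, M j * v j ^ 2 := by
    intro i
    induction i with
    | zero => rw [hP0, zero_mul, Finset.sum_range_zero]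
    | succ i ih =>
      have h : P (i + 1) = x ^ 2 * F (i + 1) ^ 2 * (P i + x ^ 2 * M i * F i ^ 2) := by
        linear_combination F (i + 1) * hP i - P (i + 1) * hF i
      rw [h, Finset.sum_range_succ, ← ih, hF' (i + 1), hF' i]
      have := hne (i + 1)
      have := hne i
      field_simp
  refine ⟨hne k, ?_⟩
  induction k with
  | zero => rw [hQ0, zero_mul, Finset.sum_range_zero, mul_zero]
  | succ i ih =>
    have h : Q (i + 1) = F (i + 1) * (x ^ 2 * (Q i * F (i + 1) + P i * G (i + 1) +
        G i * P (i + 1)) + x ^ 4 * M i * (2 * (G i * F i * F (i + 1)) +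
        F i ^ 2 * G (i + 1))) := by
      linear_combination F (i + 1) * hQ i - Q (i + 1) * hF i
    rw [Finset.sum_range_succ, mul_add, ← ih, ← hP' (i + 1)]
    have hP1 : P (i + 1) * v (i + 2) ^ 2 = P i * v (i + 1) ^ 2 + M i * v i ^ 2 := by
      rw [hP' (i + 1), hP' i, Finset.sum_range_succ]
    have n1 := hne (i + 1)
    have n0 := hne i
    have e1 : P (i + 1) = (P i * v (i + 1) ^ 2 + M i * v i ^ 2) / v (i + 2) ^ 2 := by
      rw [eq_div_iff (pow_ne_zero 2 n1), hP1]
    have e2 : G (i + 1) = γ / v (i + 2) ^ 2 := by rw [eq_div_iff (pow_ne_zero 2 n1), hG']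
    have e3 : G i = γ / v (i + 1) ^ 2 := by rw [eq_div_iff (pow_ne_zero 2 n0), hG']
    rw [h, e1, e2, e3, hF' (i + 1), hF' i]
    field_simp
    ring

namespace ArcTree

open PowerSeries
open RestrictedInvolutions (V Y)

/-- The embedding of power series in Laurent series. -/
noncomputable abbrev toLaurent : PowerSeries ℚ →+* LaurentSeries ℚ := HahnSeries.ofPowerSeries ℤ ℚ

theorem toLaurent_X : toLaurent X = RestrictedInvolutions.x := rfl

theorem x_ne_zero : RestrictedInvolutions.x ≠ 0 := by
  rw [← toLaurent_X, Ne, map_eq_zero_iff _ HahnSeries.ofPowerSeries_injective]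
  exact X_ne_zero

theorem one_sub_x_ne_zero : 1 - RestrictedInvolutions.x ≠ 0 := by
  rw [← toLaurent_X, ← map_one toLaurent, ← map_sub, Ne,
    map_eq_zero_iff _ HahnSeries.ofPowerSeries_injective]
  intro h
  have := congrArg (coeff 0) h
  simp at this

theorem x_mul_V_add_two (n : ℤ) : RestrictedInvolutions.x * V (n + 2) =
    (1 - RestrictedInvolutions.x) * V (n + 1) - RestrictedInvolutions.x * V n := by
  have hx := x_ne_zero
  have h2 : (2 : LaurentSeries ℚ) ≠ 0 := by
    have := algebraRat.charZero (LaurentSeries ℚ)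
    exact two_ne_zero
  simp only [V, Polynomial.Chebyshev.U_add_two, map_sub, map_mul, map_ofNat, Polynomial.aeval_X]
  field_simp

theorem V_zero : V 0 = 1 := by simp [V]

theorem V_neg_one : V (-1) = 0 := by simp [V]

theorem x_mul_Y_one : RestrictedInvolutions.x * Y 1 = 1 := by
  have := x_mul_V_add_two (-1)
  norm_num [V_zero, V_neg_one] at this
  rw [Y, mul_add, this]
  norm_num [V_zero]

theorem Y_zero : Y 0 = 1 := by
  rw [Y, V_zero, show (0 : ℤ) - 1 = -1 by norm_num, V_neg_one, add_zero]

theorem x_mul_Y_add_two (n : ℤ) : RestrictedInvolutions.x * Y (n + 2) =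
    (1 - RestrictedInvolutions.x) * Y (n + 1) - RestrictedInvolutions.x * Y n := by
  have h1 := x_mul_V_add_two n
  have h2 := x_mul_V_add_two (n - 1)
  rw [show n - 1 + 2 = n + 2 - 1 by ring, show n - 1 + 1 = n + 1 - 1 by ring] at h2
  rw [Y, Y, Y]
  linear_combination h1 + h2

theorem one_sub_x_mul_geom (k : ℕ) :
    (1 - RestrictedInvolutions.x) * toLaurent (geom k) = 1 - RestrictedInvolutions.x ^ k := by
  have := congrArg toLaurent (one_sub_X_mul_geom k)
  simpa only [map_mul, map_sub, map_one, map_pow, toLaurent_X] using this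

/-- `genQ` along the indices of one parity `e`, by `closed_form_of_recurrences`. -/
theorem toLaurent_genQ {γ : LaurentSeries ℚ} {v : ℕ → LaurentSeries ℚ} (e : ℕ) (hv1 : v 1 ≠ 0)
    (hv : ∀ i, RestrictedInvolutions.x * v (i + 2) =
      (1 - RestrictedInvolutions.x) * v (i + 1) - RestrictedInvolutions.x * v i)
    (hF0 : toLaurent (genF e) * (RestrictedInvolutions.x * v 1) = v 0)
    (hG0 : toLaurent (genG e) * v 1 ^ 2 = γ) (hP0 : genP e = 0) (hQ0 : genQ e = 0) (k : ℕ) :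
    toLaurent (genQ (2 * k + e)) = 2 * RestrictedInvolutions.x * γ /
      ((1 - RestrictedInvolutions.x) * v (k + 1) ^ 2) * ∑ l ∈ Finset.range k,
      ((1 - RestrictedInvolutions.x ^ (2 * l + e)) * v l * v (l + 2) +
        ∑ j ∈ Finset.range (l + 1), (1 - RestrictedInvolutions.x ^ (2 * j + e)) * v j ^ 2) /
        (v (l + 1) * v (l + 2)) := by
  have hi : ∀ i, 2 * (i + 1) + e = 2 * i + e + 2 := fun i => by ring
  obtain ⟨hne, h⟩ := closed_form_of_recurrences (x := RestrictedInvolutions.x) (γ := γ) (v := v)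
    (F := fun i => toLaurent (genF (2 * i + e))) (G := fun i => toLaurent (genG (2 * i + e)))
    (P := fun i => toLaurent (genP (2 * i + e))) (Q := fun i => toLaurent (genQ (2 * i + e)))
    (M := fun i => toLaurent (geom (2 * i + e))) x_ne_zero hv1 hv
    (by simpa using hF0) (by simpa using hG0) (by simp [hP0]) (by simp [hQ0])
    (fun i => by
      have := congrArg toLaurent (genF_add_two (2 * i + e))
      simpa only [hi, map_mul, map_add, map_one, map_pow, toLaurent_X] using this)
    (fun i => by
      have := congrArg toLaurent (genG_add_two (2 * i + e))
      simpa only [hi, map_mul, map_add, map_one, map_pow, toLaurent_X] using this)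
    (fun i => by
      have := congrArg toLaurent (genP_add_two (2 * i + e))
      simpa only [hi, map_mul, map_add, map_one, map_pow, toLaurent_X] using this)
    (fun i => by
      have := congrArg toLaurent (genQ_add_two (2 * i + e))
      simpa only [hi, map_mul, map_add, map_one, map_pow, toLaurent_X] using this) k
  have h1 := one_sub_x_ne_zero
  rw [← eq_div_iff (pow_ne_zero 2 hne)] at h
  rw [h, div_mul_eq_mul_div, div_eq_div_iff (pow_ne_zero 2 hne)
    (mul_ne_zero h1 (pow_ne_zero 2 hne))]
  have : ∑ l ∈ Finset.range k,
      ((1 - RestrictedInvolutions.x ^ (2 * l + e)) * v l * v (l + 2) +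
        ∑ j ∈ Finset.range (l + 1), (1 - RestrictedInvolutions.x ^ (2 * j + e)) * v j ^ 2) /
        (v (l + 1) * v (l + 2)) = (1 - RestrictedInvolutions.x) * ∑ l ∈ Finset.range k,
      (toLaurent (geom (2 * l + e)) * v l * v (l + 2) +
        ∑ j ∈ Finset.range (l + 1), toLaurent (geom (2 * j + e)) * v j ^ 2) /
        (v (l + 1) * v (l + 2)) := by
    simp only [← one_sub_x_mul_geom, mul_assoc, ← Finset.mul_sum, ← mul_add, mul_div_assoc]
  rw [this]
  ring

/-- Here `v i = V (i - 1)`. The summand with index `1`, where the geometric sum is empty, is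
dropped. -/
theorem toLaurent_genQ_even {k : ℕ} (hk : 2 ≤ k) : toLaurent (genQ (2 * k)) =
    2 * RestrictedInvolutions.x / ((1 - RestrictedInvolutions.x) * V k ^ 2) *
      ∑ i ∈ Finset.Icc 2 k,
        ((1 - RestrictedInvolutions.x ^ (2 * (i - 1))) * V ((i : ℤ) - 2) * V i +
          ∑ j ∈ Finset.Icc 0 (i - 2), (1 - RestrictedInvolutions.x ^ (2 * (j + 1))) * V j ^ 2) /
        (V ((i : ℤ) - 1) * V i) := by
  have h := toLaurent_genQ (γ := 1) (v := fun i => V ((i : ℤ) - 1)) 0 (by simp [V_zero])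
    (fun i => by
      have := x_mul_V_add_two ((i : ℤ) - 1)
      push_cast
      convert this using 3 <;> ring_nf)
    (by simp [genF_zero, V_neg_one]) (by simp [genG_zero, V_zero]) genP_zero genQ_zero k
  rw [add_zero, mul_one] at h
  rw [h]
  congr 1
  · push_cast; ring_nf
  obtain ⟨k, rfl⟩ := Nat.exists_eq_add_of_le' (show 1 ≤ k by omega)
  clear h hk
  induction k with
  | zero => simp [V_neg_one]
  | succ k ih =>
    rw [Finset.sum_range_succ, ih, Finset.sum_Icc_succ_top (a := 2) (b := k + 1) (by omega),
      Nat.add_sub_cancel,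
      show k + 1 + 1 - 2 = k by omega, ← Nat.range_succ_eq_Icc_zero,
      Finset.sum_range_succ' _ (k + 1)]
    congr 1
    push_cast
    have e1 : (k : ℤ) + 1 + 1 - 2 = k := by ring
    have e2 : (k : ℤ) + 1 + 2 - 1 = k + 1 + 1 := by ring
    simp [e1, e2, add_sub_cancel_right]

/-- Here `v i = Y i`, and the constant is `1 / x` because `G` begins with `x` and `Y 1 = 1 / x`. -/
theorem toLaurent_genQ_odd {k : ℕ} (hk : 2 ≤ k) : toLaurent (genQ (2 * k + 1)) =
    2 / ((1 - RestrictedInvolutions.x) * Y ((k : ℤ) + 1) ^ 2) *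
      ∑ i ∈ Finset.Icc 0 (k - 1),
        ((1 - RestrictedInvolutions.x ^ (2 * i + 1)) * Y i * Y ((i : ℤ) + 2) +
          ∑ j ∈ Finset.Icc 0 i, (1 - RestrictedInvolutions.x ^ (2 * j + 1)) * Y j ^ 2) /
        (Y ((i : ℤ) + 1) * Y ((i : ℤ) + 2)) := by
  have hx := x_ne_zero
  have h := toLaurent_genQ (γ := 1 / RestrictedInvolutions.x) (v := fun i => Y i) 1
    (fun h => by
      have := x_mul_Y_one
      simp only [Nat.cast_one] at h
      rw [h, mul_zero] at this
      exact zero_ne_one this)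
    (fun i => by
      have := x_mul_Y_add_two i
      push_cast
      exact this)
    (by simp [genF_one, x_mul_Y_one, Y_zero])
    (by
      rw [genG_one, toLaurent_X, eq_div_iff hx, Nat.cast_one]
      linear_combination (RestrictedInvolutions.x * Y 1 + 1) * x_mul_Y_one)
    genP_one genQ_one k
  rw [h]
  congr 1
  · push_cast
    congr 1
    field_simp
  · obtain ⟨k, rfl⟩ := Nat.exists_eq_add_of_le' (show 1 ≤ k by omega)
    rw [Nat.add_sub_cancel, ← Nat.range_succ_eq_Icc_zero]
    simp only [← Nat.range_succ_eq_Icc_zero]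
    push_cast
    rfl

/-- The generating function for `4321` is `2 x ^ 6 (1 - x ^ 2) / (1 - 2 x) ^ 3`. -/
theorem genQ_four : (1 - 2 * X) ^ 3 * genQ 4 = 2 * X ^ 6 * (1 - X ^ 2) := by
  have g0 : geom 0 = 0 := by ext m; simp [geom]
  have g2 : geom 2 = 1 + X := by
    ext m
    rcases m with _ | _ | m <;> simp [geom, coeff_X, coeff_one]
  have f2 : (1 - X) * genF 2 = 1 := by
    have := genF_add_two 0
    simp only [genF_zero, zero_add] at this
    linear_combination this
  have G2 : genG 2 = X ^ 2 * genF 2 ^ 2 := by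
    have := genG_add_two 0
    simp only [genF_zero, genG_zero, zero_add] at this
    linear_combination genF 2 * this - genG 2 * f2
  have P2 : genP 2 = 0 := by
    have := genP_add_two 0
    simp only [genF_zero, genP_zero, g0, zero_add] at this
    linear_combination genF 2 * this - genP 2 * f2
  have Q2 : genQ 2 = 0 := by
    have := genQ_add_two 0
    simp only [genF_zero, genP_zero, genQ_zero, genG_zero, g0, P2, zero_add] at this
    linear_combination genF 2 * this - genQ 2 * f2
  have f4' := genF_add_two 2
  have f4 : (1 - 2 * X) * genF 4 = 1 - X := by
    linear_combination (1 - X) * f4' + X ^ 2 * genF 4 * f2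
  have G4 : (1 - 2 * X) ^ 2 * genG 4 = X ^ 4 := by
    have h1 := genG_add_two 2
    have h2 : genG 4 = X ^ 2 * genG 2 * genF 4 ^ 2 := by
      linear_combination genF 4 * h1 - genG 4 * f4'
    rw [h2, G2]
    linear_combination X ^ 4 * genF 2 ^ 2 * ((1 - 2 * X) * genF 4 + (1 - X)) * f4 +
      X ^ 4 * ((1 - X) * genF 2 + 1) * f2
  have P4 : (1 - 2 * X) ^ 2 * genP 4 = X ^ 4 * (1 + X) := by
    have h1 := genP_add_two 2
    have h2 : genP 4 = X ^ 4 * (1 + X) * genF 2 ^ 2 * genF 4 ^ 2 := by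
      rw [P2, g2] at h1
      linear_combination genF 4 * h1 - genP 4 * f4'
    rw [h2]
    linear_combination X ^ 4 * (1 + X) * genF 2 ^ 2 * ((1 - 2 * X) * genF 4 + (1 - X)) * f4 +
      X ^ 4 * (1 + X) * ((1 - X) * genF 2 + 1) * f2
  have h1 := genQ_add_two 2
  have h2 : genQ 4 = genF 4 * (X ^ 2 * (genG 2 * genP 4) + X ^ 4 * (1 + X) *
      (2 * (genG 2 * genF 2 * genF 4) + genF 2 ^ 2 * genG 4)) := by
    rw [P2, Q2, g2] at h1
    linear_combination genF 4 * h1 - genQ 4 * f4'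
  have h3 : (1 - 2 * X) ^ 3 * genQ 4 = ((1 - 2 * X) * genF 4) * (X ^ 2 * (genG 2 *
      ((1 - 2 * X) ^ 2 * genP 4)) + X ^ 4 * (1 + X) * (2 * (genG 2 * genF 2 *
      ((1 - 2 * X) * genF 4)) * (1 - 2 * X) + genF 2 ^ 2 * ((1 - 2 * X) ^ 2 * genG 4))) := by
    rw [h2]; ring
  rw [h3, f4, G4, P4, G2]
  linear_combination (2 * X ^ 8 * (1 + X) * genF 2 + 2 * X ^ 6 * (1 + X) * (1 - 2 * X) * genF 2 *
    ((1 - X) * genF 2 + 1) + 2 * X ^ 6 * (1 + X) * (1 - X)) * f2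

theorem coeff_genQ_four {n : ℕ} (hn : 6 ≤ n) :
    coeff n (genQ 4) = (3 * (n : ℚ) ^ 2 - 23 * n + 38) * (2 : ℚ) ^ ((n : ℤ) - 8) := by
  -- The linear recurrence with characteristic polynomial `(z - 2) ^ 3`.
  have h : genQ 4 = C 2 * X ^ 6 - C 2 * X ^ 8 + (C 6 * (X * genQ 4) - C 12 * (X * (X * genQ 4)) +
      C 8 * (X * (X * (X * genQ 4)))) := by
    simp only [map_ofNat]
    linear_combination genQ_four
  have h0 : coeff 0 (genQ 4) = 0 := by rw [h]; simp
  have h1 : coeff 1 (genQ 4) = 0 := by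
    rw [h]
    simp only [map_add, map_sub, coeff_C_mul, coeff_X_pow, coeff_succ_X_mul, coeff_zero_X_mul, h0]
    norm_num
  have h2 : coeff 2 (genQ 4) = 0 := by
    rw [h]
    simp only [map_add, map_sub, coeff_C_mul, coeff_X_pow, coeff_succ_X_mul, coeff_zero_X_mul, h0,
      h1]
    norm_num
  have hr : ∀ m, coeff (m + 3) (genQ 4) = 2 * (if m + 3 = 6 then 1 else 0) -
      2 * (if m + 3 = 8 then 1 else 0) + (6 * coeff (m + 2) (genQ 4) -
      12 * coeff (m + 1) (genQ 4) + 8 * coeff m (genQ 4)) := by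
    intro m
    conv_lhs => rw [h]
    simp only [map_add, map_sub, coeff_C_mul, coeff_X_pow, coeff_succ_X_mul]
  have h3 := hr 0
  have h4 := hr 1
  have h5 := hr 2
  have h6 := hr 3
  have h7 := hr 4
  have h8 := hr 5
  norm_num [h0, h1, h2] at h3
  norm_num [h1, h2, h3] at h4
  norm_num [h2, h3, h4] at h5
  norm_num [h3, h4, h5] at h6
  norm_num [h4, h5, h6] at h7
  norm_num [h5, h6, h7] at h8
  rw [zpow_sub₀ two_ne_zero, zpow_natCast]
  obtain ⟨n, rfl⟩ := Nat.exists_eq_add_of_le' hn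
  clear hn
  induction n using Nat.strong_induction_on with
  | _ n ih =>
    rcases n with _ | _ | _ | n
    · norm_num [h6]
    · norm_num [h7]
    · norm_num [h8]
    · have r := hr (n + 6)
      have i0 := ih n (by omega)
      have i1 := ih (n + 1) (by omega)
      have i2 := ih (n + 2) (by omega)
      rw [if_neg (by omega), if_neg (by omega)] at r
      rw [show n + 6 + 3 = n + 3 + 6 by ring, show n + 6 + 2 = n + 2 + 6 by ring,
        show n + 6 + 1 = n + 1 + 6 by ring, i0, i1, i2] at r
      rw [r]
      push_cast
      ring

end ArcTree

theorem mainTheorem11 :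
    (∀ k : ℕ, 2 ≤ k →
      ((RestrictedInvolutions.Qplus (RestrictedInvolutions.decreasing (2 * k)) :
          PowerSeries ℚ) : LaurentSeries ℚ) =
        2 * RestrictedInvolutions.x /
            ((1 - RestrictedInvolutions.x) * RestrictedInvolutions.V k ^ 2) *
          ∑ i ∈ Finset.Icc 2 k,
            ((1 - RestrictedInvolutions.x ^ (2 * (i - 1))) *
                  RestrictedInvolutions.V ((i : ℤ) - 2) * RestrictedInvolutions.V i +
                ∑ j ∈ Finset.Icc 0 (i - 2),
                  (1 - RestrictedInvolutions.x ^ (2 * (j + 1))) *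
                    RestrictedInvolutions.V j ^ 2) /
              (RestrictedInvolutions.V ((i : ℤ) - 1) * RestrictedInvolutions.V i)) ∧
    (∀ k : ℕ, 2 ≤ k →
      ((RestrictedInvolutions.Qplus (RestrictedInvolutions.decreasing (2 * k + 1)) :
          PowerSeries ℚ) : LaurentSeries ℚ) =
        2 / ((1 - RestrictedInvolutions.x) * RestrictedInvolutions.Y ((k : ℤ) + 1) ^ 2) *
          ∑ i ∈ Finset.Icc 0 (k - 1),
            ((1 - RestrictedInvolutions.x ^ (2 * i + 1)) *
                  RestrictedInvolutions.Y i * RestrictedInvolutions.Y ((i : ℤ) + 2) +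
                ∑ j ∈ Finset.Icc 0 i,
                  (1 - RestrictedInvolutions.x ^ (2 * j + 1)) *
                    RestrictedInvolutions.Y j ^ 2) /
              (RestrictedInvolutions.Y ((i : ℤ) + 1) * RestrictedInvolutions.Y ((i : ℤ) + 2))) ∧
    (∀ n : ℕ, 6 ≤ n →
      ((RestrictedInvolutions.involutionsOnce n
          (RestrictedInvolutions.decreasing 4)).card : ℚ) =
        (3 * (n : ℚ) ^ 2 - 23 * (n : ℚ) + 38) * (2 : ℚ) ^ ((n : ℤ) - 8)) := by
  refine ⟨fun k hk => ?_, fun k hk => ?_, fun n hn => ?_⟩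
  · rw [ArcTree.Qplus_eq_genQ (by omega)]
    exact ArcTree.toLaurent_genQ_even hk
  · rw [ArcTree.Qplus_eq_genQ (by omega)]
    exact ArcTree.toLaurent_genQ_odd hk
  · rw [← ArcTree.coeff_genQ_four hn, ← ArcTree.Qplus_eq_genQ (by omega),
      RestrictedInvolutions.Qplus, PowerSeries.coeff_mk]
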